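/- Let $k\ge 1$, let $\mathcal Y=\{y\in\mathbb R^k: y_j>0 \text{ for all } j,\ \sum_{j=1}^k y_j=1\}$, let $$\Psi(y)=\Big(\log\tfrac{y_1}{g(y)},\dots,\log\tfrac{y_k}{g(y)}\Big),\qquad g(y)=\Big(\prod_{j=1}^k y_j\Big)^{1/k},$$ be the centred log-ratio map, and equip $\mathcal Y$ with the Aitchison metric $d(x,y)=\|\Psi(x)-\Psi(y)\|$ ($\|\cdot\|$ Euclidean) and its Borel $\sigma$-algebra. The (conditional) Fréchet mean is $\mathbb E_\oplus[Z\mid A]=\arg\min_{y\in\mathcal Y}\mathbb E[d^2(y,Z)\mid A]$. Let $Y_0,Y_1$ be random elements of $\mathcal Y$ and $S_0,S_1,D$ be $\{0,1\}$-valued random variables such that $D$ is independent of $(Y_1,Y_0,S_1,S_0)$ (random assignment) and $S_1\ge S_0$ almost surely (monotonicity). One observes $(D,S,Y)$, where $S=S_1D+S_0(1-D)$, and $Y=Y_1D+Y_0(1-D)$ if $S=1$, while $Y=\mathrm{NA}$ if $S=0$. Let $R$ be the distribution of $(D,S,Y)$. Assume $P(D=1)>0$, $P(S=1,D=0)>0$,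 and the following regularity conditions: $\mathbb E[\|\Psi(Y)\|^2\mid S=1,D=d]<\infty$ for $d=0,1$; and, for every $u\in\mathbb R^k$ with $\|u\|=1$ and $\sum_j u_j=0$, the conditional distribution of $\langle u,\Psi(Y)\rangle$ given $D=1,S=1$ has no atoms. Put $p=P(S=1\mid D=0)/P(S=1\mid D=1)$, let $\mu$ be the conditional law of $\Psi(Y)$ given $D=1,S=1$, and for a unit vector $u\in\mathbb R^k$ let $$\sigma(u)=\mathbb E\big[\langle u,\Psi(Y)\rangle \,\big|\, D=1,\,S=1,\,\langle u,\Psi(Y)\rangle\ge Q_u(1-p)\big],$$ where $Q_u(q)=\inf\{t: P(\langle u,\Psi(Y)\rangle\le t\mid D=1,S=1)\ge q\}$ (so $Q_u(0)=-\infty$). Put $$\mathcal S_1=\bigcap_{u\in\mathbb R^k,\ \|u\|=1}\{v\in\mathbb R^k:\langle u,v\rangle\le\sigma(u)\}.$$ The sharp identified set of a parameter $\theta$ is the set of all values $\theta(\gamma)$, where $\gamma$ ranges over the joint laws of $(Y_0,Y_1,S_0,S_1,D)$ that satisfy random assignment and monotonicity and under which the distribution of the observed data is $R$. Let $\mu_{t\oplus}=\mathbb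 E_\oplus[Y_t\mid S_1=S_0=1]$ for $t\in\{0,1\}$. Then: 1. $\mu_{0\oplus}$ is point identified: the three Fréchet means $$\mu_{0\oplus},\qquad \mathbb E_\oplus[Y_0\mid S_1=S_0=1,D=0],\qquad \mathbb E_\oplus[Y\mid S=1,D=0]$$ exist, are unique and coincide, and the sharp identified set of $\mu_{0\oplus}$ is the one-point set consisting of this common value. 2. $\mu_{1\oplus}$ exists, is unique and belongs to $\Psi^{-1}(\mathcal S_1)$. The sharp identified set of $\mathbb E[\Psi(Y_1)\mid S_1=S_0=1]$ is $\mathcal S_1$, which also equals $$\Big\{\tfrac1p\int x\,d\nu(x)\ :\ \nu,\eta \text{ nonnegative measures on } \mathbb R^k,\ \nu+\eta=\mu,\ \nu(\mathbb R^k)=p\Big\},$$ and the sharp identified set of $\mu_{1\oplus}$ is $\Psi^{-1}(\mathcal S_1)$. -/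

import Mathlib

open MeasureTheory ProbabilityTheory
open scoped ENNReal

namespace LeeBounds

/-- The `k`-part compositions with strictly positive components: `y_j > 0` and `∑ j, y_j = 1`. -/
structure Composition (k : ℕ) where
  val : Fin k → ℝ
  pos : ∀ j, 0 < val j
  sum_eq_one : ∑ j, val j = 1

/-- The geometric mean `g(x) = (∏ j, x_j) ^ (1 / k)`. -/
noncomputable def geomMean {k : ℕ} (x : Composition k) : ℝ :=
  (∏ j, x.val j) ^ (1 / (k : ℝ))

/-- The centred log-ratio map `Ψ(x) = (log (x_1 / g(x)), …, log (x_k / g(x)))`, with values in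
Euclidean `k`-space. -/
noncomputable def clr {k : ℕ} (x : Composition k) : EuclideanSpace ℝ (Fin k) :=
  WithLp.toLp 2 (fun j => Real.log (x.val j / geomMean x))

theorem geomMean_pos {k : ℕ} (x : Composition k) : 0 < geomMean x :=
  Real.rpow_pos_of_pos (Finset.prod_pos fun j _ => x.pos j) _

theorem clr_injective {k : ℕ} : Function.Injective (clr (k := k)) := by
  intro x y h
  have key : ∀ j, x.val j = (geomMean x / geomMean y) * y.val j := by
    intro j
    have hj : Real.log (x.val j / geomMean x) = Real.log (y.val j / geomMean y) :=
      congrArg (fun v : EuclideanSpace ℝ (Fin k) => v j) h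
    have hx := geomMean_pos x
    have hy := geomMean_pos y
    have := Real.log_injOn_pos (Set.mem_Ioi.2 (div_pos (x.pos j) hx))
      (Set.mem_Ioi.2 (div_pos (y.pos j) hy)) hj
    field_simp at this ⊢
    linarith
  have hc : geomMean x / geomMean y = 1 := by
    have h1 := x.sum_eq_one
    rw [Finset.sum_congr rfl fun j _ => key j, ← Finset.mul_sum, y.sum_eq_one, mul_one] at h1
    exact h1
  have hv : x.val = y.val := funext fun j => by rw [key j, hc, one_mul]
  cases x
  cases y
  cases hv
  rfl

/-- The Aitchison metric `d(x, y) = ‖Ψ(x) - Ψ(y)‖`. -/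
noncomputable instance (k : ℕ) : MetricSpace (Composition k) :=
  MetricSpace.induced clr clr_injective inferInstance

theorem dist_eq {k : ℕ} (x y : Composition k) : dist x y = ‖clr x - clr y‖ :=
  dist_eq_norm (clr x) (clr y)

/-- Compositions carry the Borel σ-algebra of the Aitchison metric. -/
noncomputable instance (k : ℕ) : MeasurableSpace (Composition k) := borel _

instance (k : ℕ) : BorelSpace (Composition k) := ⟨rfl⟩

/-- The set `argmin_y E[d²(y, Z)]` of Fréchet means of a random composition `Z` with law `μ`. -/
def frechetMeanSet {k : ℕ} (μ : Measure (Composition k)) : Set (Composition k) :=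
  {m | ∀ y, ∫⁻ z, ENNReal.ofReal (dist m z ^ 2) ∂μ ≤ ∫⁻ z, ENNReal.ofReal (dist y z ^ 2) ∂μ}

/-- The conditional law of `Y` given the event `A`. -/
noncomputable def condLaw {Ω E : Type*} [MeasurableSpace Ω] [MeasurableSpace E]
    (P : Measure Ω) (Y : Ω → E) (A : Set Ω) : Measure E :=
  (P[|A]).map Y

/-- The latent variables of the sample selection model, namely potential outcomes `Y₀, Y₁`,
potential selection indicators `S₀, S₁` and treatment `D`, under random assignment and
monotonicity. -/
structure IsSelectionModel {Ω : Type*} [MeasurableSpace Ω] {k : ℕ} (P : Measure Ω)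
    (Y₀ Y₁ : Ω → Composition k) (S₀ S₁ D : Ω → Bool) : Prop where
  isProbabilityMeasure : IsProbabilityMeasure P
  measurable_Y₀ : Measurable Y₀
  measurable_Y₁ : Measurable Y₁
  measurable_S₀ : Measurable S₀
  measurable_S₁ : Measurable S₁
  measurable_D : Measurable D
  random_assignment : IndepFun D (fun ω => (Y₁ ω, Y₀ ω, S₁ ω, S₀ ω)) P
  monotonicity : ∀ᵐ ω ∂P, S₀ ω ≤ S₁ ω

/-- The event `S₁ = S₀ = 1` (always observed). -/
def alwaysObserved {Ω : Type*} (S₀ S₁ : Ω → Bool) : Set Ω :=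
  {ω | S₁ ω = true ∧ S₀ ω = true}

/-- One observation `(D, S, Y)`, where `Y` is a composition or `NA` (`Sum.inr ()`). -/
abbrev Obs (k : ℕ) : Type := Bool × Bool × (Composition k ⊕ Unit)

/-- The observation generated by the selection model: `S = S₁ D + S₀ (1 - D)`, and
`Y = Y₁ D + Y₀ (1 - D)` if `S = 1`, `Y = NA` if `S = 0`. -/
def observe {k : ℕ} (y₀ y₁ : Composition k) (s₀ s₁ d : Bool) : Obs k :=
  let s := if d = true then s₁ else s₀
  (d, s, if s = true then Sum.inl (if d = true then y₁ else y₀) else Sum.inr ())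

/-- The distribution of the observed data `(D, S, Y)`. -/
noncomputable def obsLaw {Ω : Type*} [MeasurableSpace Ω] {k : ℕ} (P : Measure Ω)
    (Y₀ Y₁ : Ω → Composition k) (S₀ S₁ D : Ω → Bool) : Measure (Obs k) :=
  P.map (fun ω => observe (Y₀ ω) (Y₁ ω) (S₀ ω) (S₁ ω) (D ω))

/-- The conditional law of the observed outcome `Y` given `S = 1` and `D = d`. On this event `Y` is
a composition. -/
noncomputable def outcomeLaw {k : ℕ} (R : Measure (Obs k)) (d : Bool) : Measure (Composition k) :=
  (condLaw R (fun o => o.2.2) {o | o.2.1 = true ∧ o.1 = d}).comap Sum.inl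

/-- `p = P(S = 1 | D = 0) / P(S = 1 | D = 1)`. -/
noncomputable def selectionRatio {k : ℕ} (R : Measure (Obs k)) : ℝ :=
  (R[|{o | o.1 = false}]).real {o | o.2.1 = true} /
    (R[|{o | o.1 = true}]).real {o | o.2.1 = true}

/-- The law of `Ψ(Y)` given `D = 1` and `S = 1`. -/
noncomputable def treatedLaw {k : ℕ} (R : Measure (Obs k)) : Measure (EuclideanSpace ℝ (Fin k)) :=
  (outcomeLaw R true).map clr

/-- The `q`-th quantile `inf {t | q ≤ F(t)}` of a law on the line with distribution function `F`,
as an extended real, so that the quantile of order `0` is `-∞`. -/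
noncomputable def quantile (ν : Measure ℝ) (q : ℝ) : EReal :=
  sInf ((fun t : ℝ => (t : EReal)) '' {t : ℝ | q ≤ ν.real (Set.Iic t)})

/-- `σ(u) = E[⟨u, X⟩ | ⟨u, X⟩ ≥ Q(1 - p)]` for `X` with law `μ`, where `Q` is the quantile function
of `⟨u, X⟩`. -/
noncomputable def upperTailMean {k : ℕ} (μ : Measure (EuclideanSpace ℝ (Fin k))) (p : ℝ)
    (u : EuclideanSpace ℝ (Fin k)) : ℝ :=
  ∫ x, inner ℝ u x
    ∂(μ[|{x | quantile (μ.map fun z => inner ℝ u z) (1 - p) ≤ ((inner ℝ u x : ℝ) : EReal)}])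

/-- The set `𝒮₁` of all `v` with `⟨u, v⟩ ≤ σ(u)` for every unit vector `u`, as a function of the
distribution of the observed data. -/
def boundSet {k : ℕ} (R : Measure (Obs k)) : Set (EuclideanSpace ℝ (Fin k)) :=
  {v | ∀ u, ‖u‖ = 1 → inner ℝ u v ≤ upperTailMean (treatedLaw R) (selectionRatio R) u}

/-- Values of the latent variables `(Y₀, Y₁, S₀, S₁, D)`. -/
abbrev Latent (k : ℕ) : Type := Composition k × Composition k × Bool × Bool × Bool

/-- `γ` is the joint law of `(Y₀, Y₁, S₀, S₁, D)` for some selection model. -/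
def IsModelLaw {k : ℕ} (γ : Measure (Latent k)) : Prop :=
  IsSelectionModel γ (fun l => l.1) (fun l => l.2.1) (fun l => l.2.2.1) (fun l => l.2.2.2.1)
    (fun l => l.2.2.2.2)

/-- The distribution of the observed data under the joint law `γ` of the latent variables. -/
noncomputable def modelObsLaw {k : ℕ} (γ : Measure (Latent k)) : Measure (Obs k) :=
  obsLaw γ (fun l => l.1) (fun l => l.2.1) (fun l => l.2.2.1) (fun l => l.2.2.2.1)
    (fun l => l.2.2.2.2)

/-- The event `S₁ = S₀ = 1` in the space of values of the latent variables. -/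
def latentAlwaysObserved (k : ℕ) : Set (Latent k) :=
  alwaysObserved (fun l => l.2.2.1) (fun l => l.2.2.2.1)

/-- The sharp identified set `{θ(γ) : γ ∈ Γ, P_γ = R}` of a parameter `θ`, where `Γ` consists of all
selection models, `P_γ` is the distribution of the observed data under `γ`, and `θ γ t` says that
`t` is the value of the parameter under `γ`. -/
def sharpIdentifiedSet {k : ℕ} {Θ : Type*} (θ : Measure (Latent k) → Θ → Prop)
    (R : Measure (Obs k)) : Set Θ :=
  {t | ∃ γ : Measure (Latent k), IsModelLaw γ ∧ modelObsLaw γ = R ∧ θ γ t}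

/-- `m` is the Fréchet mean of `Y₀` given `S₁ = S₀ = 1` under `γ`. -/
def IsMuZero {k : ℕ} (γ : Measure (Latent k)) (m : Composition k) : Prop :=
  frechetMeanSet (condLaw γ (fun l => l.1) (latentAlwaysObserved k)) = {m}

/-- `m` is the Fréchet mean of `Y₁` given `S₁ = S₀ = 1` under `γ`. -/
def IsMuOne {k : ℕ} (γ : Measure (Latent k)) (m : Composition k) : Prop :=
  frechetMeanSet (condLaw γ (fun l => l.2.1) (latentAlwaysObserved k)) = {m}

/-- `v = E[Ψ(Y₁) | S₁ = S₀ = 1]` under `γ`. -/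
def IsClrMeanOne {k : ℕ} (γ : Measure (Latent k)) (v : EuclideanSpace ℝ (Fin k)) : Prop :=
  Integrable (fun l : Latent k => clr l.2.1) (γ[|latentAlwaysObserved k]) ∧
    v = ∫ l, clr l.2.1 ∂(γ[|latentAlwaysObserved k])

/-- The set of all `p⁻¹ ∫ x dν(x)` over the decompositions `μ = ν + η` into nonnegative measures
with `ν` of total mass `p`, where `μ` is the law of `Ψ(Y)` given `D = 1` and `S = 1`. -/
def mixtureSet {k : ℕ} (R : Measure (Obs k)) : Set (EuclideanSpace ℝ (Fin k)) :=
  {v | ∃ ν η : Measure (EuclideanSpace ℝ (Fin k)), ν + η = treatedLaw R ∧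
    ν Set.univ = ENNReal.ofReal (selectionRatio R) ∧
    v = (selectionRatio R)⁻¹ • ∫ x, x ∂ν}

end LeeBounds

namespace LeeBounds

/-! The map `clr` is an isometry of compositions onto the hyperplane of vectors with coordinate sum
zero. The hyperplane contains the mean of every law that it carries, so under a finite second moment
the Fréchet mean is the unique composition whose `clr` is the Euclidean mean. Everything becomes a
question about Euclidean means.

By random assignment the law of the data depends on a model only through the law of `D` and the
sub-probability laws of `Y₀` on `S₀ = 1` and of `Y₁` on `S₁ = 1` (`obsLaw_eq`). By monotonicity the
always observed are almost surely the units with `S₀ = 1`. Their control outcomes therefore have the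
law seen in the control arm, which gives point identification. Their treated outcomes, suitably
scaled, form a part `ν` of mass `p` of the observed treated law (`exists_add_eq_outcomeLaw`).
Conversely every part of mass `p` arises (`exists_isModelLaw`): couple it independently with the
control outcomes and give the rest of the treated law to units observed only under treatment. Hence
the identified set is `mixtureSet`.

This set is convex and compact, so its support function determines it. In a direction without atoms
the best part of mass `p` is the upper tail (`integral_le_setIntegral_of_add_eq`), whose mass is
exactly `p`; this gives `upperTailMean`. In the normal direction of the hyperplane both sides
vanish. Compactness comes from the weak-* compactness of the densities with values in `[0, 1]`, and
Hahn–Banach concludes (`exists_add_eq_of_forall_inner_le`). -/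

instance : IsEmpty (Composition 0) := ⟨fun x => by simpa using x.sum_eq_one⟩

/-! ### Centred log-ratio coordinates -/

theorem clr_apply {k : ℕ} (x : Composition k) (j : Fin k) :
    clr x j = Real.log (x.val j) - Real.log (geomMean x) :=
  Real.log_div (x.pos j).ne' (geomMean_pos x).ne'

theorem log_geomMean {k : ℕ} (x : Composition k) :
    Real.log (geomMean x) = 1 / k * ∑ j, Real.log (x.val j) := by
  rw [geomMean, Real.log_rpow (Finset.prod_pos fun j _ => x.pos j),
    Real.log_prod fun j _ => (x.pos j).ne']

theorem sum_clr {k : ℕ} (x : Composition k) : ∑ j, clr x j = 0 := by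
  rcases Nat.eq_zero_or_pos k with rfl | hk
  · simp
  · have : (k : ℝ) ≠ 0 := by positivity
    simp only [clr_apply, Finset.sum_sub_distrib, log_geomMean, Finset.sum_const, Finset.card_univ,
      Fintype.card_fin, nsmul_eq_mul]
    field_simp
    ring

/-- The softmax of `v` is a preimage: normalisation shifts all logarithms by the same constant, and
centring removes it. -/
theorem exists_clr_eq {k : ℕ} [NeZero k] {v : EuclideanSpace ℝ (Fin k)} (hv : ∑ j, v j = 0) :
    ∃ x : Composition k, clr x = v := by
  have hs : 0 < ∑ i, Real.exp (v i) :=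
    Finset.sum_pos (fun i _ => Real.exp_pos _) Finset.univ_nonempty
  have hk : (k : ℝ) ≠ 0 := Nat.cast_ne_zero.2 (NeZero.ne k)
  refine ⟨⟨fun j => Real.exp (v j) / ∑ i, Real.exp (v i), fun j => by positivity, ?_⟩, ?_⟩
  · rw [← Finset.sum_div, div_self hs.ne']
  · ext j
    rw [clr_apply, log_geomMean]
    simp only [Real.log_div (Real.exp_ne_zero _) hs.ne', Real.log_exp, Finset.sum_sub_distrib, hv,
      Finset.sum_const, Finset.card_univ, Fintype.card_fin, nsmul_eq_mul]
    field_simp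
    ring

theorem isometry_clr {k : ℕ} : Isometry (clr (k := k)) :=
  Isometry.of_dist_eq fun _ _ => rfl

theorem continuous_clr {k : ℕ} : Continuous (clr (k := k)) := isometry_clr.continuous

theorem measurable_clr {k : ℕ} : Measurable (clr (k := k)) := continuous_clr.measurable

theorem range_clr {k : ℕ} [NeZero k] : Set.range (clr (k := k)) = {v | ∑ j, v j = 0} :=
  Set.Subset.antisymm (by rintro _ ⟨x, rfl⟩; exact sum_clr x) fun _ hv => exists_clr_eq hv

/-- The range is a closed hyperplane. This is what allows measures on Euclidean space to be pulled
back to compositions. -/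
theorem measurableEmbedding_clr {k : ℕ} [NeZero k] : MeasurableEmbedding (clr (k := k)) := by
  refine Topology.IsClosedEmbedding.measurableEmbedding ⟨isometry_clr.isEmbedding, ?_⟩
  rw [range_clr]
  exact isClosed_eq (by fun_prop) continuous_const

/-! ### Fréchet means as Euclidean means -/

/-- The law `ρ` has a finite second moment in the Aitchison geometry. -/
def HasSecondMoment {k : ℕ} (ρ : Measure (Composition k)) : Prop :=
  ∫⁻ y, ENNReal.ofReal (‖clr y‖ ^ 2) ∂ρ < ∞

theorem HasSecondMoment.memLp {k : ℕ} {ρ : Measure (Composition k)} (h : HasSecondMoment ρ) :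
    MemLp clr 2 ρ := by
  have hm : AEStronglyMeasurable (clr (k := k)) ρ :=
    (measurable_clr.stronglyMeasurable).aestronglyMeasurable
  refine (memLp_two_iff_integrable_sq_norm hm).2 ⟨(by fun_prop), ?_⟩
  rw [hasFiniteIntegral_iff_ofReal (Filter.Eventually.of_forall fun _ => sq_nonneg _)]
  exact h

/-- Bias-variance decomposition: expanding around the mean, the cross term integrates to zero. -/
theorem integral_norm_sub_sq {α E : Type*} [MeasurableSpace α] [NormedAddCommGroup E]
    [InnerProductSpace ℝ E] [CompleteSpace E] {ρ : Measure α} [IsProbabilityMeasure ρ] {f : α → E}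
    (hf : MemLp f 2 ρ) (v : E) :
    ∫ z, ‖v - f z‖ ^ 2 ∂ρ
      = ‖v - ∫ z, f z ∂ρ‖ ^ 2 + ∫ z, ‖(∫ z, f z ∂ρ) - f z‖ ^ 2 ∂ρ := by
  set m := ∫ z, f z ∂ρ with hm
  have hfi : Integrable f ρ := hf.integrable (by norm_num)
  have hmf : MemLp (fun z => m - f z) 2 ρ := (memLp_const m).sub hf
  have hmi : Integrable (fun z => m - f z) ρ := hmf.integrable (by norm_num)
  have hsq : Integrable (fun z => ‖m - f z‖ ^ 2) ρ := (memLp_two_iff_integrable_sq_norm hmf.1).1 hmf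
  have hexp : ∀ z, ‖v - f z‖ ^ 2 = ‖v - m‖ ^ 2 + (2 * inner ℝ (v - m) (m - f z) + ‖m - f z‖ ^ 2) := by
    intro z
    rw [show v - f z = (v - m) + (m - f z) by abel, norm_add_sq_real]
    ring
  have hin : Integrable (fun z => 2 * inner ℝ (v - m) (m - f z)) ρ :=
    (hmi.const_inner (v - m)).const_mul 2
  have hz : ∫ z, inner ℝ (v - m) (m - f z) ∂ρ = 0 := by
    rw [integral_inner hmi, integral_sub (integrable_const m) hfi, ← hm]
    simp
  simp_rw [hexp]
  have h2 : Integrable (fun z => 2 * inner ℝ (v - m) (m - f z) + ‖m - f z‖ ^ 2) ρ := hin.add hsq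
  rw [integral_add (integrable_const _) h2, integral_add hin hsq, integral_const_mul, hz]
  simp

/-- By the bias-variance decomposition the objective at `y` is `‖clr y - clr m‖ ^ 2` plus a finite
constant, so `m` is its only minimiser. -/
theorem frechetMeanSet_eq_singleton {k : ℕ} {ρ : Measure (Composition k)} [IsProbabilityMeasure ρ]
    (h : HasSecondMoment ρ) {m : Composition k} (hm : clr m = ∫ z, clr z ∂ρ) :
    frechetMeanSet ρ = {m} := by
  have hL := h.memLp
  have hval : ∀ y : Composition k, ∫⁻ z, ENNReal.ofReal (dist y z ^ 2) ∂ρ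
      = ENNReal.ofReal (‖clr y - clr m‖ ^ 2 + ∫ z, ‖clr m - clr z‖ ^ 2 ∂ρ) := by
    intro y
    have h2 : MemLp (fun z => clr y - clr z) 2 ρ := (memLp_const (clr y)).sub hL
    have := integral_norm_sub_sq hL (clr y)
    rw [← hm] at this
    rw [← this, ofReal_integral_eq_lintegral_ofReal ((memLp_two_iff_integrable_sq_norm h2.1).1 h2)
      (Filter.Eventually.of_forall fun _ => sq_nonneg _)]
    rfl
  have hnn : 0 ≤ ∫ z, ‖clr m - clr z‖ ^ 2 ∂ρ := integral_nonneg fun _ => sq_nonneg _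
  ext y
  simp only [frechetMeanSet, Set.mem_ofPred_eq, Set.mem_singleton_iff, hval]
  constructor
  · intro hy
    have h1 := (ENNReal.ofReal_le_ofReal_iff (by positivity)).1 (hy m)
    have h2 : ‖clr y - clr m‖ ^ 2 ≤ 0 := by simpa using h1
    exact clr_injective (sub_eq_zero.1 (by simpa using h2))
  · rintro rfl z
    apply ENNReal.ofReal_le_ofReal
    simp

/-- The equation of the hyperplane is linear and passes through the integral, so the mean is again
in the range of `clr`. -/
theorem exists_clr_eq_integral {k : ℕ} [NeZero k] {ρ : Measure (Composition k)}
    (h : Integrable clr ρ) : ∃ m : Composition k, clr m = ∫ z, clr z ∂ρ := by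
  apply exists_clr_eq
  have : ∀ j, (∫ z, clr z ∂ρ) j = ∫ z, clr z j ∂ρ := fun j =>
    ((EuclideanSpace.proj (𝕜 := ℝ) j).integral_comp_comm h).symm
  simp_rw [this]
  rw [← integral_finsetSum (f := fun j z => clr z j) _ fun j _ =>
    (EuclideanSpace.proj (𝕜 := ℝ) j).integrable_comp h]
  simp [sum_clr]

/-! ### Quantiles, upper tails and directions -/

open Filter Topology in
-- The limits of the distribution function at `±∞` make the quantile finite. There, right continuity
-- gives a value at least `q`, and the absence of a jump gives at most `q`.
theorem exists_quantile_eq (ν : Measure ℝ) [IsProbabilityMeasure ν] (hν : ∀ t, ν {t} = 0) {q : ℝ}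
    (hq0 : 0 < q) (hq1 : q < 1) : ∃ t : ℝ, quantile ν q = t ∧ ν.real (Set.Iio t) = q := by
  set S : Set ℝ := {t | q ≤ ν.real (Set.Iic t)} with hS
  have hcdf : ∀ t, ν.real (Set.Iic t) = cdf ν t := fun t => (cdf_eq_real ν t).symm
  have hne : S.Nonempty :=
    (((tendsto_cdf_atTop ν).eventually (lt_mem_nhds hq1)).exists).imp fun t ht => by
      rw [hS, Set.mem_ofPred_eq, hcdf]; exact ht.le
  obtain ⟨b, hb⟩ := ((tendsto_cdf_atBot ν).eventually (gt_mem_nhds hq0)).exists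
  have hbdd : BddBelow S := ⟨b, fun t ht => by
    rw [hS, Set.mem_ofPred_eq, hcdf] at ht
    by_contra! h
    exact absurd (monotone_cdf ν h.le) (by linarith)⟩
  refine ⟨sInf S, ?_, ?_⟩
  · apply le_antisymm
    · obtain ⟨s, -, hs, hs'⟩ := exists_seq_tendsto_sInf hne hbdd
      refine ge_of_tendsto ((continuous_coe_real_ereal.tendsto _).comp hs)
        (Eventually.of_forall fun n => sInf_le ⟨_, hs' n, rfl⟩)
    · refine le_sInf ?_
      rintro _ ⟨t, ht, rfl⟩
      exact EReal.coe_le_coe_iff.2 (csInf_le hbdd ht)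
  · have hIio : ν.real (Set.Iio (sInf S)) = cdf ν (sInf S) := by
      rw [← hcdf, ← Set.Iio_union_right]
      refine measureReal_congr ?_
      exact (union_ae_eq_left_of_ae_eq_empty (ae_eq_empty.2 (hν _))).symm
    have hleft : cdf ν (sInf S) ≤ Function.leftLim (cdf ν) (sInf S) := by
      have h := (cdf ν).measure_singleton (sInf S)
      rw [measure_cdf, hν, eq_comm, ENNReal.ofReal_eq_zero] at h
      linarith
    rw [hIio]
    apply le_antisymm
    · refine hleft.trans (le_of_tendsto ((monotone_cdf ν).tendsto_leftLim _) ?_)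
      filter_upwards [self_mem_nhdsWithin] with t ht
      by_contra! h
      exact absurd (csInf_le hbdd (show t ∈ S by rw [hS, Set.mem_ofPred_eq, hcdf]; exact h.le))
        (not_le.2 ht)
    · have hr : Tendsto (cdf ν) (𝓝[>] sInf S) (𝓝 (cdf ν (sInf S))) :=
        ((cdf ν).right_continuous _).mono_left (nhdsWithin_mono _ Set.Ioi_subset_Ici_self)
      refine ge_of_tendsto hr ?_
      filter_upwards [self_mem_nhdsWithin] with t ht
      obtain ⟨s, hs, hst⟩ := exists_lt_of_csInf_lt hne ht
      rw [hS, Set.mem_ofPred_eq, hcdf] at hs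
      exact hs.trans (monotone_cdf ν hst.le)

/-- Bathtub principle. Replace `Z` by `Z - t`: discarding the complement of the tail removes a
negative contribution, and enlarging `ν` to `μ` on the tail adds a nonnegative one. The terms in `t`
cancel because the masses agree. -/
theorem integral_le_setIntegral_of_add_eq {α : Type*} [MeasurableSpace α] {μ ν η : Measure α}
    [IsFiniteMeasure μ] (h : ν + η = μ) {Z : α → ℝ} (hZ : Measurable Z) (hZi : Integrable Z μ)
    (t : ℝ) (hν : ν Set.univ = μ {x | t ≤ Z x}) :
    ∫ x, Z x ∂ν ≤ ∫ x in {x | t ≤ Z x}, Z x ∂μ := by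
  set A := {x | t ≤ Z x} with hAdef
  have hA : MeasurableSet A := measurableSet_le measurable_const hZ
  have hle : ν ≤ μ := h ▸ Measure.le_add_right le_rfl
  have : IsFiniteMeasure ν := isFiniteMeasure_of_le μ hle
  have hμt : Integrable (fun x => Z x - t) μ := hZi.sub (integrable_const t)
  have hνt : Integrable (fun x => Z x - t) ν := hμt.mono_measure hle
  have h1 : ∫ x, (Z x - t) ∂ν ≤ ∫ x in A, (Z x - t) ∂ν := by
    rw [← integral_add_compl hA hνt, add_le_iff_nonpos_right]
    refine setIntegral_nonpos hA.compl fun x hx => ?_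
    have : Z x < t := not_le.1 hx
    linarith
  have h2 : ∫ x in A, (Z x - t) ∂ν ≤ ∫ x in A, (Z x - t) ∂μ := by
    refine integral_mono_measure (Measure.restrict_mono le_rfl hle) ?_ hμt.integrableOn
    filter_upwards [ae_restrict_mem hA] with x hx
    exact sub_nonneg.2 hx
  have h3 := h1.trans h2
  rw [integral_sub (hZi.mono_measure hle) (integrable_const t),
    integral_sub hZi.integrableOn (integrable_const t)] at h3
  have : ν.real Set.univ = μ.real A := by rw [measureReal_def, measureReal_def, hν]
  simp only [integral_const, MeasurableSet.univ, measureReal_restrict_apply, Set.univ_inter, this]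
    at h3
  linarith

/-- The upper tail event in the direction `u`. -/
def upperTail {k : ℕ} (μ : Measure (EuclideanSpace ℝ (Fin k))) (p : ℝ)
    (u : EuclideanSpace ℝ (Fin k)) : Set (EuclideanSpace ℝ (Fin k)) :=
  {x | quantile (μ.map fun z => inner ℝ u z) (1 - p) ≤ ((inner ℝ u x : ℝ) : EReal)}

theorem measurableSet_upperTail {k : ℕ} (μ : Measure (EuclideanSpace ℝ (Fin k))) (p : ℝ)
    (u : EuclideanSpace ℝ (Fin k)) :
    MeasurableSet (upperTail μ p u) :=
  measurableSet_le measurable_const (by fun_prop)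

section Directions

variable {k : ℕ} {μ : Measure (EuclideanSpace ℝ (Fin k))} [IsProbabilityMeasure μ]

theorem quantile_of_nonpos (ν : Measure ℝ) {q : ℝ} (hq : q ≤ 0) : quantile ν q = ⊥ := by
  have : {t : ℝ | q ≤ ν.real (Set.Iic t)} = Set.univ :=
    Set.eq_univ_of_forall fun t => hq.trans measureReal_nonneg
  rw [quantile, this, Set.image_univ, sInf_eq_bot]
  intro b hb
  obtain ⟨x, hx⟩ := EReal.lt_iff_exists_real_btwn.1 hb
  exact ⟨x, ⟨x, rfl⟩, hx.2⟩

/-- The case `p = 1` is separate because the quantile of order `0` is `⊥`, and no real threshold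
need exist. -/
theorem upperTail_eq {p : ℝ} (hp0 : 0 < p) (hp1 : p ≤ 1) {u : EuclideanSpace ℝ (Fin k)}
    (hu : ∀ t, μ {x | inner ℝ u x = t} = 0) :
    upperTail μ p u = Set.univ ∧ p = 1 ∨
      ∃ t : ℝ, upperTail μ p u = {x | t ≤ inner ℝ u x} ∧ μ.real {x | t ≤ inner ℝ u x} = p := by
  have hm : Measurable fun z : EuclideanSpace ℝ (Fin k) => inner ℝ u z := by fun_prop
  rcases hp1.eq_or_lt with rfl | hp1
  · left
    simp [upperTail, quantile_of_nonpos]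
  · right
    have := Measure.isProbabilityMeasure_map (μ := μ) hm.aemeasurable
    obtain ⟨t, ht, ht'⟩ := exists_quantile_eq (μ.map fun z => inner ℝ u z)
      (fun t => by rw [Measure.map_apply hm (measurableSet_singleton t)]; exact hu t)
      (sub_pos.2 hp1) (sub_lt_self 1 hp0)
    refine ⟨t, by simp only [upperTail, ht, EReal.coe_le_coe_iff], ?_⟩
    rw [map_measureReal_apply hm measurableSet_Iio] at ht'
    have hc : {x : EuclideanSpace ℝ (Fin k) | t ≤ inner ℝ u x}
        = ((fun z => inner ℝ u z) ⁻¹' Set.Iio t)ᶜ := by ext; simp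
    rw [hc, probReal_compl_eq_one_sub (hm measurableSet_Iio), ht']
    ring

theorem measureReal_upperTail {p : ℝ} (hp0 : 0 < p) (hp1 : p ≤ 1) {u : EuclideanSpace ℝ (Fin k)}
    (hu : ∀ t, μ {x | inner ℝ u x = t} = 0) : μ.real (upperTail μ p u) = p := by
  rcases upperTail_eq hp0 hp1 hu with ⟨h, rfl⟩ | ⟨t, h, h'⟩
  · simp [h]
  · rw [h, h']

theorem mul_upperTailMean {p : ℝ} (hp0 : 0 < p) (hp1 : p ≤ 1) {u : EuclideanSpace ℝ (Fin k)}
    (hu : ∀ t, μ {x | inner ℝ u x = t} = 0) :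
    p * upperTailMean μ p u = ∫ x in upperTail μ p u, inner ℝ u x ∂μ := by
  have h : (μ (upperTail μ p u)).toReal = p := measureReal_upperTail hp0 hp1 hu
  change p * ∫ x, inner ℝ u x ∂(μ[|upperTail μ p u]) = _
  rw [ProbabilityTheory.cond, integral_smul_measure, ENNReal.toReal_inv, h, smul_eq_mul,
    mul_inv_cancel_left₀ hp0.ne']

theorem integral_inner_le_mul_upperTailMean {p : ℝ} (hp0 : 0 < p) (hp1 : p ≤ 1)
    (hμ : Integrable id μ) {u : EuclideanSpace ℝ (Fin k)}
    (hu : ∀ t, μ {x | inner ℝ u x = t} = 0) {ν η : Measure (EuclideanSpace ℝ (Fin k))}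
    (h : ν + η = μ) (hν : ν Set.univ = ENNReal.ofReal p) :
    ∫ x, inner ℝ u x ∂ν ≤ p * upperTailMean μ p u := by
  rw [mul_upperTailMean hp0 hp1 hu]
  have hmass : ν Set.univ = μ (upperTail μ p u) := by
    have hA := measureReal_upperTail hp0 hp1 hu
    rw [hν, ← ofReal_measureReal (μ := μ), hA]
  rcases upperTail_eq hp0 hp1 hu with ⟨h', rfl⟩ | ⟨t, h', -⟩
  · have hη : η Set.univ = 0 := by
      have h1 : ν Set.univ + η Set.univ = 1 := by
        rw [← Measure.add_apply, h, measure_univ]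
      rw [hν, ENNReal.ofReal_one] at h1
      simpa using h1
    rw [Measure.measure_univ_eq_zero] at hη
    rw [h', Measure.restrict_univ, ← h, hη, add_zero]
  · rw [h'] at hmass ⊢
    exact integral_le_setIntegral_of_add_eq h (by fun_prop) (hμ.const_inner u) t hmass

end Directions

/-- In every direction a law on the hyperplane `∑ j, x j = 0` is either atomless or degenerate, if
it is atomless in the directions of the hyperplane. -/
theorem inner_atomless_or_ae_eq_zero {k : ℕ} {μ : Measure (EuclideanSpace ℝ (Fin k))}
    (hH : ∀ᵐ x ∂μ, ∑ j, x j = 0)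
    (hcont : ∀ u : EuclideanSpace ℝ (Fin k), ‖u‖ = 1 → ∑ j, u j = 0 →
      ∀ t : ℝ, μ {x | inner ℝ u x = t} = 0) (u : EuclideanSpace ℝ (Fin k)) :
    (∀ t, μ {x | inner ℝ u x = t} = 0) ∨ ∀ᵐ x ∂μ, inner ℝ u x = 0 := by
  -- `w` is the orthogonal projection of `u` to the hyperplane, so both have the same inner products
  -- with its points. Either `w = 0`, or the hypothesis applies to `w` normalised.
  set c : ℝ := (∑ j, u j) / k with hc
  set w : EuclideanSpace ℝ (Fin k) := WithLp.toLp 2 fun j => u j - c with hw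
  have hsum : ∑ j, w j = 0 := by
    rcases Nat.eq_zero_or_pos k with rfl | hk
    · simp
    · have : (k : ℝ) ≠ 0 := by positivity
      simp only [hw, Finset.sum_sub_distrib, Finset.sum_const, Finset.card_univ, Fintype.card_fin,
        nsmul_eq_mul, hc]
      field_simp
      ring
  have hinner : ∀ᵐ x ∂μ, inner ℝ u x = inner ℝ w x := by
    filter_upwards [hH] with x hx
    simp only [PiLp.inner_apply, RCLike.inner_apply, conj_trivial, hw, mul_sub,
      Finset.sum_sub_distrib, ← Finset.sum_mul, hx]
    ring
  by_cases hw0 : w = 0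
  · right
    filter_upwards [hinner] with x hx
    rw [hx, hw0, inner_zero_left]
  · left
    intro t
    have hn : ‖w‖ ≠ 0 := norm_ne_zero_iff.2 hw0
    have h0 := hcont (‖w‖⁻¹ • w) (by rw [norm_smul, norm_inv, norm_norm, inv_mul_cancel₀ hn])
      (by simp only [PiLp.smul_apply, smul_eq_mul, ← Finset.mul_sum, hsum, mul_zero]) (‖w‖⁻¹ * t)
    refine (measure_congr ?_).trans h0
    filter_upwards [hinner] with x hx
    change (inner ℝ u x = t) = (inner ℝ (‖w‖⁻¹ • w) x = ‖w‖⁻¹ * t)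
    rw [hx, real_inner_smul_left]
    exact propext (mul_right_injective₀ (inv_ne_zero hn)).eq_iff.symm

theorem upperTailMean_eq_zero {k : ℕ} {μ : Measure (EuclideanSpace ℝ (Fin k))} (p : ℝ)
    {u : EuclideanSpace ℝ (Fin k)} (hu : ∀ᵐ x ∂μ, inner ℝ u x = 0) : upperTailMean μ p u = 0 :=
  integral_eq_zero_of_ae (cond_absolutelyContinuous.ae_le hu)

/-! ### Partial means: weak-* compactness and support function -/

/-- The functionals on `L²` given by densities with values in `[0, 1]` and integral `p`. -/
def densityFunctionals {α : Type*} [MeasurableSpace α] (μ : Measure α) [IsFiniteMeasure μ] (p : ℝ) :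
    Set (WeakDual ℝ (Lp ℝ 2 μ)) :=
  WeakDual.toStrongDual ⁻¹' Metric.closedBall 0 1 ∩
    {φ | (∀ s, ∀ hs : MeasurableSet s,
        φ (indicatorConstLp 2 hs (measure_ne_top μ s) 1) ∈ Set.Icc 0 (μ.real s)) ∧
      φ (indicatorConstLp 2 .univ (measure_ne_top μ _) 1) = p}

/-- Banach–Alaoglu: the remaining constraints are closed conditions on evaluations at fixed elements
of `L²`. -/
theorem isCompact_densityFunctionals {α : Type*} [MeasurableSpace α] (μ : Measure α)
    [IsFiniteMeasure μ] (p : ℝ) : IsCompact (densityFunctionals μ p) := by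
  refine (WeakDual.isCompact_closedBall _ _).inter_right ?_
  refine IsClosed.inter ?_ (isClosed_eq (WeakDual.eval_continuous _) continuous_const)
  have : {φ : WeakDual ℝ (Lp ℝ 2 μ) | ∀ s, ∀ hs : MeasurableSet s,
        φ (indicatorConstLp 2 hs (measure_ne_top μ s) 1) ∈ Set.Icc 0 (μ.real s)}
      = ⋂ s, ⋂ hs : MeasurableSet s, (fun φ : WeakDual ℝ (Lp ℝ 2 μ) =>
        φ (indicatorConstLp 2 hs (measure_ne_top μ s) 1)) ⁻¹' Set.Icc 0 (μ.real s) := by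
    ext φ
    simp only [Set.mem_ofPred_eq, Set.mem_iInter, Set.mem_preimage]
  change IsClosed {φ : WeakDual ℝ (Lp ℝ 2 μ) | ∀ s, ∀ hs : MeasurableSet s,
        φ (indicatorConstLp 2 hs (measure_ne_top μ s) 1) ∈ Set.Icc 0 (μ.real s)}
  rw [this]
  exact isClosed_iInter fun s => isClosed_iInter fun hs =>
    isClosed_Icc.preimage (WeakDual.eval_continuous _)

theorem convex_densityFunctionals {α : Type*} [MeasurableSpace α] (μ : Measure α)
    [IsFiniteMeasure μ] (p : ℝ) : Convex ℝ (densityFunctionals μ p) := by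
  refine ((convex_closedBall (0 : StrongDual ℝ (Lp ℝ 2 μ)) 1).linear_preimage
    WeakDual.toStrongDual.toLinearMap).inter ?_
  intro φ hφ ψ hψ a b ha hb hab
  have key : ∀ g : Lp ℝ 2 μ, (a • φ + b • ψ) g = a * φ g + b * ψ g := fun _ => rfl
  refine ⟨fun s hs => ?_, ?_⟩
  · rw [key]
    exact convex_Icc 0 (μ.real s) (hφ.1 s hs) (hψ.1 s hs) ha hb hab
  · rw [key, hφ.2, hψ.2, ← add_mul, hab, one_mul]

/-- The Riesz representative `f` is the density of `ν`; testing on indicators forces `0 ≤ f ≤ 1`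
almost everywhere, so `1 - f` is a density for `η`. -/
theorem exists_density_of_mem {α : Type*} [MeasurableSpace α] {μ : Measure α} [IsFiniteMeasure μ]
    {p : ℝ} {φ : WeakDual ℝ (Lp ℝ 2 μ)} (hφ : φ ∈ densityFunctionals μ p) :
    ∃ ν η : Measure α, ν + η = μ ∧ ν Set.univ = ENNReal.ofReal p ∧
      ∀ g : Lp ℝ 2 μ, φ g = ∫ x, g x ∂ν := by
  obtain ⟨-, hφ, hφp⟩ := hφ
  set f : Lp ℝ 2 μ := (InnerProductSpace.toDual ℝ (Lp ℝ 2 μ)).symm (WeakDual.toStrongDual φ)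
  have hf : ∀ g : Lp ℝ 2 μ, φ g = inner ℝ f g := fun g =>
    (InnerProductSpace.toDual_symm_apply (𝕜 := ℝ)).symm
  have hfi : Integrable f μ := (Lp.memLp f).integrable (by norm_num)
  have hset : ∀ s, ∀ hs : MeasurableSet s,
      φ (indicatorConstLp 2 hs (measure_ne_top μ s) 1) = ∫ x in s, f x ∂μ := fun s hs => by
    rw [hf, real_inner_comm, L2.inner_indicatorConstLp_one]
  have hf0 : 0 ≤ᵐ[μ] f := ae_nonneg_of_forall_setIntegral_nonneg hfi fun s hs _ => by
    rw [← hset s hs]; exact (hφ s hs).1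
  have hf1 : f ≤ᵐ[μ] fun _ => 1 :=
    ae_le_of_forall_setIntegral_le hfi (integrable_const 1) fun s hs _ => by
      rw [← hset s hs]; simpa using (hφ s hs).2
  have hmeas : AEMeasurable f μ := (Lp.aestronglyMeasurable f).aemeasurable
  refine ⟨μ.withDensity fun x => ENNReal.ofReal (f x),
    μ.withDensity fun x => ENNReal.ofReal (1 - f x), ?_, ?_, fun g => ?_⟩
  · rw [← withDensity_add_left (Lp.stronglyMeasurable f).measurable.ennreal_ofReal]
    conv_rhs => rw [← withDensity_one (μ := μ)]
    refine withDensity_congr_ae ?_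
    filter_upwards [hf0, hf1] with x h0 h1
    have h0 : 0 ≤ f x := h0
    rw [Pi.add_apply, ← ENNReal.ofReal_add h0 (sub_nonneg.2 h1)]
    simp
  · rw [withDensity_apply _ .univ, Measure.restrict_univ, ← ofReal_integral_eq_lintegral_ofReal hfi
      hf0, ← hφp, hset _ .univ, Measure.restrict_univ]
  · rw [integral_withDensity_eq_integral_toReal_smul₀ (by fun_prop) (by simp), hf, L2.inner_def]
    refine integral_congr_ae ?_
    filter_upwards [hf0] with x h0
    have h0 : 0 ≤ f x := h0
    simp [ENNReal.toReal_ofReal h0, mul_comm]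

/-- Pairing with `f` is the functional. Since `μ` is a probability measure and `f` is bounded by
`1`, the unit ball constraint holds automatically. -/
theorem exists_mem_of_density {α : Type*} [MeasurableSpace α] {μ : Measure α}
    [IsProbabilityMeasure μ] {f : α → ℝ} (hf : Measurable f) (h0 : ∀ x, 0 ≤ f x) (h1 : ∀ x, f x ≤ 1) :
    ∃ φ ∈ densityFunctionals μ (∫ x, f x ∂μ), ∀ g : Lp ℝ 2 μ, φ g = ∫ x, f x * g x ∂μ := by
  have hb : ∀ x, ‖f x‖ ≤ 1 := fun x => by rw [Real.norm_of_nonneg (h0 x)]; exact h1 x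
  have hL : MemLp f 2 μ := MemLp.of_bound hf.aestronglyMeasurable 1 (.of_forall hb)
  have key : ∀ g : Lp ℝ 2 μ, inner ℝ (hL.toLp f) g = ∫ x, f x * g x ∂μ := fun g => by
    rw [L2.inner_def]
    refine integral_congr_ae ?_
    filter_upwards [hL.coeFn_toLp] with x hx
    simp [hx, mul_comm]
  have hfi : Integrable f μ := hL.integrable (by norm_num)
  have hset : ∀ s, ∀ hs : MeasurableSet s,
      inner ℝ (hL.toLp f) (indicatorConstLp 2 hs (measure_ne_top μ s) (1 : ℝ))
        = ∫ x in s, f x ∂μ := fun s hs => by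
    rw [real_inner_comm, L2.inner_indicatorConstLp_one]
    exact setIntegral_congr_ae hs (hL.coeFn_toLp.mono fun x hx _ => hx)
  refine ⟨StrongDual.toWeakDual (InnerProductSpace.toDual ℝ (Lp ℝ 2 μ) (hL.toLp f)),
    ⟨?_, fun s hs => ?_, ?_⟩, key⟩
  · rw [Set.mem_preimage, StrongDual.toStrongDual_toWeakDual, mem_closedBall_zero_iff,
      LinearIsometryEquiv.norm_map, Lp.norm_toLp]
    refine ENNReal.toReal_le_of_le_ofReal zero_le_one ?_
    refine (eLpNorm_le_of_ae_bound (.of_forall hb)).trans ?_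
    simp
  · change inner ℝ (hL.toLp f) (indicatorConstLp 2 hs (measure_ne_top μ s) (1 : ℝ)) ∈ _
    rw [hset s hs]
    refine ⟨integral_nonneg h0, ?_⟩
    refine (integral_mono hfi.integrableOn (integrable_const 1) h1).trans ?_
    simp
  · change inner ℝ (hL.toLp f) (indicatorConstLp 2 .univ (measure_ne_top μ _) (1 : ℝ)) = _
    rw [hset _ .univ, Measure.restrict_univ]

/-- A vector that no direction separates from the partial means of `μ` of mass `p` is one. -/
theorem exists_add_eq_of_forall_inner_le {k : ℕ} [NeZero k]
    {μ : Measure (EuclideanSpace ℝ (Fin k))} [IsProbabilityMeasure μ] (hμ : MemLp id 2 μ) {p : ℝ}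
    {w : EuclideanSpace ℝ (Fin k)}
    (h : ∀ u : EuclideanSpace ℝ (Fin k), ‖u‖ = 1 → ∃ f : EuclideanSpace ℝ (Fin k) → ℝ,
      Measurable f ∧ (∀ x, 0 ≤ f x) ∧ (∀ x, f x ≤ 1) ∧ ∫ x, f x ∂μ = p ∧
        inner ℝ u w ≤ ∫ x, f x * inner ℝ u x ∂μ) :
    ∃ ν η : Measure (EuclideanSpace ℝ (Fin k)), ν + η = μ ∧ ν Set.univ = ENNReal.ofReal p ∧
      ∫ x, x ∂ν = w := by
  have hc : ∀ i, MemLp (fun x : EuclideanSpace ℝ (Fin k) => x i) 2 μ := fun i =>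
    (EuclideanSpace.proj (𝕜 := ℝ) i).comp_memLp' hμ
  -- Evaluation at the coordinate functions sends a density to its partial mean. It is linear and
  -- weak-* continuous, so the set of partial means is convex and compact.
  let T : WeakDual ℝ (Lp ℝ 2 μ) →ₗ[ℝ] EuclideanSpace ℝ (Fin k) :=
    { toFun := fun φ => WithLp.toLp 2 fun i => φ ((hc i).toLp _)
      map_add' := fun _ _ => rfl
      map_smul' := fun _ _ => rfl }
  have hTc : Continuous T :=
    (PiLp.continuous_toLp 2 _).comp (continuous_pi fun i => WeakDual.eval_continuous _)
  have hK : IsClosed (T '' densityFunctionals μ p) :=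
    ((isCompact_densityFunctionals μ p).image hTc).isClosed
  have hconv : Convex ℝ (T '' densityFunctionals μ p) :=
    (convex_densityFunctionals μ p).linear_image T
  have hint : ∀ u : EuclideanSpace ℝ (Fin k), ‖u‖ = 1 →
      ∃ v ∈ T '' densityFunctionals μ p, inner ℝ u w ≤ inner ℝ u v := by
    intro u hu
    obtain ⟨f, hf, h0, h1, rfl, hle⟩ := h u hu
    obtain ⟨φ, hφ, hφg⟩ := exists_mem_of_density (μ := μ) hf h0 h1
    refine ⟨T φ, ⟨φ, hφ, rfl⟩, hle.trans_eq ?_⟩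
    have hT : ∀ i, T φ i = ∫ x, f x * x i ∂μ := fun i => by
      change φ ((hc i).toLp _) = _
      rw [hφg]
      refine integral_congr_ae ?_
      filter_upwards [(hc i).coeFn_toLp] with x hx
      rw [hx]
    have hfb : ∀ i, Integrable (fun x : EuclideanSpace ℝ (Fin k) => f x * x i) μ := fun i =>
      ((hc i).integrable (by norm_num)).bdd_mul hf.aestronglyMeasurable (c := 1)
        (.of_forall fun x => by rw [Real.norm_of_nonneg (h0 x)]; exact h1 x)
    simp only [PiLp.inner_apply, RCLike.inner_apply, conj_trivial, hT, Finset.mul_sum]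
    rw [integral_finsetSum _ fun i _ => ((hfb i).const_mul (u i)).congr (.of_forall fun x => by ring)]
    refine Finset.sum_congr rfl fun i _ => ?_
    rw [← integral_mul_const]
    congr 1 with x
    ring
  have hw : w ∈ T '' densityFunctionals μ p := by
    by_contra hw
    obtain ⟨F, c, hF, hFw⟩ := geometric_hahn_banach_closed_point hconv hK hw
    set z := (InnerProductSpace.toDual ℝ (EuclideanSpace ℝ (Fin k))).symm F
    have hz : ∀ v, F v = inner ℝ z v := fun v =>
      (InnerProductSpace.toDual_symm_apply (𝕜 := ℝ)).symm
    -- Any point of the image shows that the separating functional is nonzero, so that it can be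
    -- normalised.
    obtain ⟨v₀, hv₀, -⟩ := hint (EuclideanSpace.single 0 1) (by simp)
    have hz0 : ‖z‖ ≠ 0 := fun h0 => by
      have h1 := (hF v₀ hv₀).trans hFw
      simp [hz, norm_eq_zero.1 h0] at h1
    obtain ⟨v, hv, hle⟩ := hint (‖z‖⁻¹ • z) (by rw [norm_smul, norm_inv, norm_norm,
      inv_mul_cancel₀ hz0])
    rw [real_inner_smul_left, real_inner_smul_left] at hle
    have h1 := (hF v hv).trans hFw
    rw [hz, hz] at h1
    exact absurd (le_of_mul_le_mul_left hle (by positivity)) (not_le.2 h1)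
  obtain ⟨φ, hφ, rfl⟩ := hw
  obtain ⟨ν, η, hadd, hmass, hg⟩ := exists_density_of_mem hφ
  have hle : ν ≤ μ := hadd ▸ Measure.le_add_right le_rfl
  have hνi : Integrable (fun x => x) ν := (hμ.integrable (by norm_num)).mono_measure hle
  refine ⟨ν, η, hadd, hmass, ?_⟩
  ext i
  change EuclideanSpace.proj (𝕜 := ℝ) i _ = φ ((hc i).toLp _)
  rw [← (EuclideanSpace.proj (𝕜 := ℝ) i).integral_comp_comm hνi, hg]
  refine integral_congr_ae ((Measure.absolutelyContinuous_of_le hle).ae_le ?_)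
  filter_upwards [(hc i).coeFn_toLp] with x hx
  rw [hx]
  rfl

/-- The partial means of mass `p` are described by their support function, the upper tail mean. -/
theorem exists_add_eq_iff_forall_inner_le_upperTailMean {k : ℕ} [NeZero k]
    {μ : Measure (EuclideanSpace ℝ (Fin k))} [IsProbabilityMeasure μ] (hμ : MemLp id 2 μ)
    (hH : ∀ᵐ x ∂μ, ∑ j, x j = 0)
    (hcont : ∀ u : EuclideanSpace ℝ (Fin k), ‖u‖ = 1 → ∑ j, u j = 0 →
      ∀ t : ℝ, μ {x | inner ℝ u x = t} = 0) {p : ℝ} (hp0 : 0 < p) (hp1 : p ≤ 1)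
    (v : EuclideanSpace ℝ (Fin k)) :
    (∃ ν η : Measure (EuclideanSpace ℝ (Fin k)), ν + η = μ ∧ ν Set.univ = ENNReal.ofReal p ∧
      v = p⁻¹ • ∫ x, x ∂ν) ↔
    ∀ u : EuclideanSpace ℝ (Fin k), ‖u‖ = 1 → inner ℝ u v ≤ upperTailMean μ p u := by
  have hi : Integrable id μ := hμ.integrable (by norm_num)
  constructor
  · rintro ⟨ν, η, hadd, hmass, rfl⟩ u -
    have hle : ν ≤ μ := hadd ▸ Measure.le_add_right le_rfl
    have hνi : Integrable (fun x => x) ν := hi.mono_measure hle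
    rw [real_inner_smul_right, ← integral_inner hνi, inv_mul_le_iff₀ hp0]
    rcases inner_atomless_or_ae_eq_zero hH hcont u with hu | hu
    · exact integral_inner_le_mul_upperTailMean hp0 hp1 hi hu hadd hmass
    · rw [upperTailMean_eq_zero p hu, mul_zero]
      exact (integral_eq_zero_of_ae ((Measure.absolutelyContinuous_of_le hle).ae_le hu)).le
  · intro hv
    suffices h : ∃ ν η : Measure (EuclideanSpace ℝ (Fin k)), ν + η = μ ∧
        ν Set.univ = ENNReal.ofReal p ∧ ∫ x, x ∂ν = p • v by
      obtain ⟨ν, η, hadd, hmass, hν⟩ := h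
      exact ⟨ν, η, hadd, hmass, by rw [hν, inv_smul_smul₀ hp0.ne']⟩
    refine exists_add_eq_of_forall_inner_le hμ fun u hu1 => ?_
    have hle := mul_le_mul_of_nonneg_left (hv u hu1) hp0.le
    rw [← real_inner_smul_right] at hle
    rcases inner_atomless_or_ae_eq_zero hH hcont u with hu | hu
    · have hA := measurableSet_upperTail μ p u
      -- The indicator of the upper tail attains the bound in the direction `u`.
      refine ⟨(upperTail μ p u).indicator 1, measurable_one.indicator hA,
        Set.indicator_nonneg fun _ _ => zero_le_one,
        Set.indicator_le' (fun _ _ => le_rfl) fun _ _ => zero_le_one, ?_, hle.trans_eq ?_⟩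
      · rw [integral_indicator_one hA, measureReal_upperTail hp0 hp1 hu]
      · rw [mul_upperTailMean hp0 hp1 hu, ← integral_indicator hA]
        congr 1 with x
        by_cases hx : x ∈ upperTail μ p u <;> simp [hx]
    -- In a degenerate direction every density gives zero; the constant `p` has the right mass.
    · refine ⟨fun _ => p, measurable_const, fun _ => hp0.le, fun _ => hp1, by simp,
        hle.trans_eq ?_⟩
      rw [upperTailMean_eq_zero p hu, integral_const_mul, integral_eq_zero_of_ae hu]

/-! ### The law of the data in terms of the potential outcomes -/

section PotentialLaw

variable {Ω Ω' E : Type*} [MeasurableSpace Ω] [MeasurableSpace Ω'] [MeasurableSpace E]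

/-- The sub-probability law of `Y` on the event `S = 1`. -/
noncomputable def selectedLaw (P : Measure Ω) (Y : Ω → E) (S : Ω → Bool) : Measure E :=
  (P.restrict {ω | S ω = true}).map Y

theorem measurableSet_eq_bool {S : Ω → Bool} (hS : Measurable S) (b : Bool) :
    MeasurableSet {ω | S ω = b} :=
  hS (measurableSet_singleton b)

theorem selectedLaw_univ (P : Measure Ω) {Y : Ω → E} (hY : Measurable Y) (S : Ω → Bool) :
    selectedLaw P Y S Set.univ = P {ω | S ω = true} := by
  rw [selectedLaw, Measure.map_apply hY .univ, Set.preimage_univ, Measure.restrict_apply_univ]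

theorem selectedLaw_map {P : Measure Ω} {φ : Ω → Ω'} (hφ : Measurable φ) {Y : Ω' → E}
    (hY : Measurable Y) {S : Ω' → Bool} (hS : Measurable S) :
    selectedLaw (P.map φ) Y S = selectedLaw P (fun ω => Y (φ ω)) (fun ω => S (φ ω)) := by
  rw [selectedLaw, Measure.restrict_map hφ (measurableSet_eq_bool hS true), Measure.map_map hY hφ]
  rfl

theorem condLaw_eq_smul (P : Measure Ω) (Y : Ω → E) (A : Set Ω) :
    condLaw P Y A = (P A)⁻¹ • (P.restrict A).map Y := by
  rw [condLaw, ProbabilityTheory.cond, Measure.map_smul]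

theorem condLaw_map {P : Measure Ω} {φ : Ω → Ω'} (hφ : Measurable φ) {Y : Ω' → E}
    (hY : Measurable Y) {A : Set Ω'} (hA : MeasurableSet A) :
    condLaw (P.map φ) Y A = condLaw P (fun ω => Y (φ ω)) (φ ⁻¹' A) := by
  rw [condLaw_eq_smul, condLaw_eq_smul, Measure.map_apply hφ hA, Measure.restrict_map hφ hA,
    Measure.map_map hY hφ]
  rfl

theorem map_restrict_of_indepFun {P : Measure Ω} {D : Ω → Bool}
    {Y : Ω → E} (hY : Measurable Y) (h : IndepFun D Y P) (d : Bool) :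
    (P.restrict {ω | D ω = d}).map Y = P {ω | D ω = d} • P.map Y := by
  ext s hs
  rw [Measure.map_apply hY hs, Measure.restrict_apply (hY hs), Measure.smul_apply,
    Measure.map_apply hY hs, Set.inter_comm]
  exact h.measure_inter_preimage_eq_mul {d} s (measurableSet_singleton d) hs

theorem restrict_true_add_restrict_false (P : Measure Ω) {D : Ω → Bool} (hD : Measurable D) :
    P.restrict {ω | D ω = true} + P.restrict {ω | D ω = false} = P := by
  have : {ω | D ω = false} = {ω | D ω = true}ᶜ := by ext; simp
  rw [this, Measure.restrict_add_restrict_compl (measurableSet_eq_bool hD true)]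

end PotentialLaw

/-- The law of one observation in the arm `d`, given the sub-probability law `α` of the outcome on
the event that it is observed. -/
noncomputable def armLaw {k : ℕ} (d : Bool) (α : Measure (Composition k)) : Measure (Obs k) :=
  α.map (fun y => (d, true, Sum.inl y)) + (1 - α Set.univ) • Measure.dirac (d, false, Sum.inr ())

/-- One observation in the arm `d`. -/
def armObs {k : ℕ} (d : Bool) (y : Composition k) (s : Bool) : Obs k :=
  (d, s, if s = true then Sum.inl y else Sum.inr ())

theorem measurable_armObs {k : ℕ} (d : Bool) {Ω : Type*} [MeasurableSpace Ω]
    {Y : Ω → Composition k} {S : Ω → Bool} (hY : Measurable Y) (hS : Measurable S) :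
    Measurable fun ω => armObs d (Y ω) (S ω) :=
  measurable_const.prodMk (hS.prodMk
    (Measurable.ite (measurableSet_eq_bool hS true) (measurable_inl.comp hY) measurable_const))

/-- Unselected units all give the same observation, so only their mass enters. -/
theorem map_armObs {k : ℕ} {Ω : Type*} [MeasurableSpace Ω] {P : Measure Ω} [IsProbabilityMeasure P]
    {Y : Ω → Composition k} {S : Ω → Bool} (hY : Measurable Y) (hS : Measurable S) (d : Bool) :
    P.map (fun ω => armObs d (Y ω) (S ω)) = armLaw d (selectedLaw P Y S) := by
  have hm := measurable_armObs d hY hS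
  conv_lhs => rw [← restrict_true_add_restrict_false P hS, Measure.map_add _ _ hm]
  rw [armLaw]
  congr 1
  · rw [selectedLaw, Measure.map_map (by fun_prop) hY]
    refine Measure.map_congr ?_
    filter_upwards [ae_restrict_mem (measurableSet_eq_bool hS true)] with ω hω
    have hω : S ω = true := hω
    simp [armObs, hω]
  · have hc : {ω | S ω = false} = {ω | S ω = true}ᶜ := by ext; simp
    rw [selectedLaw_univ P hY, ← prob_compl_eq_one_sub (measurableSet_eq_bool hS true), ← hc,
      ← Measure.restrict_apply_univ {ω | S ω = false}, ← Measure.map_const]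
    refine Measure.map_congr ?_
    filter_upwards [ae_restrict_mem (measurableSet_eq_bool hS false)] with ω hω
    have hω : S ω = false := hω
    simp [armObs, hω]

section Model

variable {k : ℕ} {Ω : Type*} [MeasurableSpace Ω] {P : Measure Ω} {Y₀ Y₁ : Ω → Composition k}
  {S₀ S₁ D : Ω → Bool}

theorem measurable_observe (hM : IsSelectionModel P Y₀ Y₁ S₀ S₁ D) :
    Measurable fun ω => observe (Y₀ ω) (Y₁ ω) (S₀ ω) (S₁ ω) (D ω) := by
  have : (fun ω => observe (Y₀ ω) (Y₁ ω) (S₀ ω) (S₁ ω) (D ω)) = fun ω =>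
      if D ω = true then armObs true (Y₁ ω) (S₁ ω) else armObs false (Y₀ ω) (S₀ ω) := by
    ext1 ω
    cases h : D ω <;> simp [observe, armObs]
  rw [this]
  exact Measurable.ite (measurableSet_eq_bool hM.measurable_D true)
    (measurable_armObs _ hM.measurable_Y₁ hM.measurable_S₁)
    (measurable_armObs _ hM.measurable_Y₀ hM.measurable_S₀)

/-- Independence of `D` turns each arm into a factor `P(D = d)` times the unconditional law of the
arm's observation. The joint law of the two arms does not enter, which is the source of partial
identification. -/
theorem obsLaw_eq (hM : IsSelectionModel P Y₀ Y₁ S₀ S₁ D) :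
    obsLaw P Y₀ Y₁ S₀ S₁ D = P {ω | D ω = true} • armLaw true (selectedLaw P Y₁ S₁)
      + P {ω | D ω = false} • armLaw false (selectedLaw P Y₀ S₀) := by
  have := hM.isProbabilityMeasure
  have hm := measurable_observe hM
  have hD := hM.measurable_D
  have hm₁ := measurable_armObs true hM.measurable_Y₁ hM.measurable_S₁
  have hm₀ := measurable_armObs false hM.measurable_Y₀ hM.measurable_S₀
  have hi₁ : IndepFun D (fun ω => armObs true (Y₁ ω) (S₁ ω)) P :=
    hM.random_assignment.comp (φ := id)
      (ψ := fun z : Composition k × Composition k × Bool × Bool => armObs true z.1 z.2.2.1)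
      measurable_id (measurable_armObs true (by fun_prop) (by fun_prop))
  have hi₀ : IndepFun D (fun ω => armObs false (Y₀ ω) (S₀ ω)) P :=
    hM.random_assignment.comp (φ := id)
      (ψ := fun z : Composition k × Composition k × Bool × Bool => armObs false z.2.1 z.2.2.2)
      measurable_id (measurable_armObs false (by fun_prop) (by fun_prop))
  rw [obsLaw]
  conv_lhs => rw [← restrict_true_add_restrict_false P hD, Measure.map_add _ _ hm]
  rw [← map_armObs hM.measurable_Y₁ hM.measurable_S₁, ← map_armObs hM.measurable_Y₀ hM.measurable_S₀,
    ← map_restrict_of_indepFun hm₁ hi₁, ← map_restrict_of_indepFun hm₀ hi₀]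
  congr 1
  · refine Measure.map_congr ?_
    filter_upwards [ae_restrict_mem (measurableSet_eq_bool hD true)] with ω hω
    have hω : D ω = true := hω
    simp [armObs, observe, hω]
  · refine Measure.map_congr ?_
    filter_upwards [ae_restrict_mem (measurableSet_eq_bool hD false)] with ω hω
    have hω : D ω = false := hω
    simp [armObs, observe, hω]

end Model

theorem armLaw_apply {k : ℕ} (d : Bool) (α : Measure (Composition k)) {E : Set (Obs k)}
    (hE : MeasurableSet E) : armLaw d α E = α {y | (d, true, Sum.inl y) ∈ E}
      + (1 - α Set.univ) * E.indicator 1 (d, false, Sum.inr ()) := by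
  rw [armLaw, Measure.add_apply, Measure.map_apply (by fun_prop) hE, Measure.smul_apply,
    Measure.dirac_apply' _ hE, smul_eq_mul]
  rfl

section Model

variable {k : ℕ} {Ω : Type*} [MeasurableSpace Ω] {P : Measure Ω} {Y₀ Y₁ : Ω → Composition k}
  {S₀ S₁ D : Ω → Bool}

theorem obsLaw_apply (hM : IsSelectionModel P Y₀ Y₁ S₀ S₁ D) {E : Set (Obs k)}
    (hE : MeasurableSet E) : obsLaw P Y₀ Y₁ S₀ S₁ D E =
      P {ω | D ω = true} * (selectedLaw P Y₁ S₁ {y | (true, true, Sum.inl y) ∈ E}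
        + (1 - P {ω | S₁ ω = true}) * E.indicator 1 (true, false, Sum.inr ()))
      + P {ω | D ω = false} * (selectedLaw P Y₀ S₀ {y | (false, true, Sum.inl y) ∈ E}
        + (1 - P {ω | S₀ ω = true}) * E.indicator 1 (false, false, Sum.inr ())) := by
  rw [obsLaw_eq hM, Measure.add_apply, Measure.smul_apply, Measure.smul_apply, armLaw_apply _ _ hE,
    armLaw_apply _ _ hE, selectedLaw_univ P hM.measurable_Y₁, selectedLaw_univ P hM.measurable_Y₀]
  rfl

theorem measurableSet_obs_arm (d : Bool) : MeasurableSet {o : Obs k | o.1 = d} :=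
  measurableSet_eq_bool measurable_fst d

theorem measurableSet_obs_selected : MeasurableSet {o : Obs k | o.2.1 = true} :=
  measurableSet_eq_bool (by fun_prop) true

theorem measurableSet_obs_selected_arm (d : Bool) :
    MeasurableSet {o : Obs k | o.2.1 = true ∧ o.1 = d} :=
  measurableSet_obs_selected.inter (measurableSet_obs_arm d)

theorem obsLaw_arm (hM : IsSelectionModel P Y₀ Y₁ S₀ S₁ D) (d : Bool) :
    obsLaw P Y₀ Y₁ S₀ S₁ D {o | o.1 = d} = P {ω | D ω = d} := by
  rw [obsLaw, Measure.map_apply (measurable_observe hM) (measurableSet_obs_arm d)]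
  rfl

theorem obsLaw_selected_true (hM : IsSelectionModel P Y₀ Y₁ S₀ S₁ D) :
    obsLaw P Y₀ Y₁ S₀ S₁ D {o | o.2.1 = true ∧ o.1 = true}
      = P {ω | D ω = true} * P {ω | S₁ ω = true} := by
  rw [obsLaw_apply hM (measurableSet_obs_selected_arm true)]
  simp [selectedLaw_univ P hM.measurable_Y₁]

theorem obsLaw_selected_false (hM : IsSelectionModel P Y₀ Y₁ S₀ S₁ D) :
    obsLaw P Y₀ Y₁ S₀ S₁ D {o | o.2.1 = true ∧ o.1 = false}
      = P {ω | D ω = false} * P {ω | S₀ ω = true} := by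
  rw [obsLaw_apply hM (measurableSet_obs_selected_arm false)]
  simp [selectedLaw_univ P hM.measurable_Y₀]

theorem outcomeLaw_apply (R : Measure (Obs k)) (d : Bool) {B : Set (Composition k)}
    (hB : MeasurableSet B) : outcomeLaw R d B = (R {o | o.2.1 = true ∧ o.1 = d})⁻¹ *
      R ({o | o.2.1 = true ∧ o.1 = d} ∩ (fun o => o.2.2) ⁻¹' (Sum.inl '' B)) := by
  rw [outcomeLaw, Measure.comap_apply _ Sum.inl_injective (fun s hs => measurableSet_inl_image.2 hs)
    _ hB, condLaw, Measure.map_apply (by fun_prop) (measurableSet_inl_image.2 hB),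
    cond_apply (measurableSet_obs_selected_arm d)]

theorem measurableSet_obs_selected_arm_inter (d : Bool) {B : Set (Composition k)}
    (hB : MeasurableSet B) : MeasurableSet
      ({o : Obs k | o.2.1 = true ∧ o.1 = d} ∩ (fun o => o.2.2) ⁻¹' (Sum.inl '' B)) :=
  (measurableSet_obs_selected_arm d).inter
    ((show Measurable fun o : Obs k => o.2.2 by fun_prop)
      (measurableSet_inl_image.2 hB))

theorem inv_mul_mul_cancel {a b c : ℝ≥0∞} (ha : a ≠ 0) (ha' : a ≠ ∞) :
    (a * b)⁻¹ * (a * c) = b⁻¹ * c := by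
  rw [ENNReal.mul_inv (.inl ha) (.inl ha'), mul_mul_mul_comm, ENNReal.inv_mul_cancel ha ha', one_mul]

theorem outcomeLaw_true (hM : IsSelectionModel P Y₀ Y₁ S₀ S₁ D) (hD : P {ω | D ω = true} ≠ 0) :
    outcomeLaw (obsLaw P Y₀ Y₁ S₀ S₁ D) true
      = (P {ω | S₁ ω = true})⁻¹ • selectedLaw P Y₁ S₁ := by
  have := hM.isProbabilityMeasure
  ext B hB
  rw [outcomeLaw_apply _ _ hB, obsLaw_selected_true hM,
    obsLaw_apply hM (measurableSet_obs_selected_arm_inter true hB)]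
  simp [inv_mul_mul_cancel hD (measure_ne_top P _)]

theorem outcomeLaw_false (hM : IsSelectionModel P Y₀ Y₁ S₀ S₁ D) (hD : P {ω | D ω = false} ≠ 0) :
    outcomeLaw (obsLaw P Y₀ Y₁ S₀ S₁ D) false
      = (P {ω | S₀ ω = true})⁻¹ • selectedLaw P Y₀ S₀ := by
  have := hM.isProbabilityMeasure
  ext B hB
  rw [outcomeLaw_apply _ _ hB, obsLaw_selected_false hM,
    obsLaw_apply hM (measurableSet_obs_selected_arm_inter false hB)]
  simp [inv_mul_mul_cancel hD (measure_ne_top P _)]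

theorem selectionRatio_eq (hM : IsSelectionModel P Y₀ Y₁ S₀ S₁ D) (hD₁ : P {ω | D ω = true} ≠ 0)
    (hD₀ : P {ω | D ω = false} ≠ 0) : selectionRatio (obsLaw P Y₀ Y₁ S₀ S₁ D)
      = P.real {ω | S₀ ω = true} / P.real {ω | S₁ ω = true} := by
  have := hM.isProbabilityMeasure
  have h : ∀ d, {o : Obs k | o.1 = d} ∩ {o | o.2.1 = true} = {o | o.2.1 = true ∧ o.1 = d} :=
    fun d => by ext; simp [and_comm]
  simp only [selectionRatio, measureReal_def, cond_apply (measurableSet_obs_arm _), h,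
    obsLaw_selected_true hM, obsLaw_selected_false hM, obsLaw_arm hM]
  rw [← mul_assoc, ← mul_assoc, ENNReal.inv_mul_cancel hD₀ (measure_ne_top _ _),
    ENNReal.inv_mul_cancel hD₁ (measure_ne_top _ _), one_mul, one_mul]

theorem measure_selected_le (hM : IsSelectionModel P Y₀ Y₁ S₀ S₁ D) :
    P {ω | S₀ ω = true} ≤ P {ω | S₁ ω = true} := by
  refine measure_mono_ae ?_
  filter_upwards [hM.monotonicity] with ω hω (h : S₀ ω = true)
  rw [h] at hω
  exact Bool.eq_true_of_true_le hω

/-- Monotonicity: `S₀ = 1` forces `S₁ = 1`. -/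
theorem alwaysObserved_ae_eq (hM : IsSelectionModel P Y₀ Y₁ S₀ S₁ D) :
    alwaysObserved S₀ S₁ =ᵐ[P] {ω | S₀ ω = true} := by
  filter_upwards [hM.monotonicity] with ω hω
  change (S₁ ω = true ∧ S₀ ω = true) = (S₀ ω = true)
  revert hω
  cases S₀ ω <;> cases S₁ ω <;> simp

theorem measurableSet_alwaysObserved (hM : IsSelectionModel P Y₀ Y₁ S₀ S₁ D) :
    MeasurableSet (alwaysObserved S₀ S₁) :=
  (measurableSet_eq_bool hM.measurable_S₁ true).inter (measurableSet_eq_bool hM.measurable_S₀ true)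

theorem condLaw_alwaysObserved_zero (hM : IsSelectionModel P Y₀ Y₁ S₀ S₁ D)
    (hD₀ : P {ω | D ω = false} ≠ 0) : condLaw P Y₀ (alwaysObserved S₀ S₁)
      = outcomeLaw (obsLaw P Y₀ Y₁ S₀ S₁ D) false := by
  rw [outcomeLaw_false hM hD₀, condLaw_eq_smul, measure_congr (alwaysObserved_ae_eq hM),
    Measure.restrict_congr_set (alwaysObserved_ae_eq hM), selectedLaw]

/-- Since `D` is independent of `(S₀, Y₀)`, further conditioning on `D = 0` only multiplies
numerator and denominator by `P(D = 0)`. -/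
theorem condLaw_alwaysObserved_zero_control (hM : IsSelectionModel P Y₀ Y₁ S₀ S₁ D)
    (hD₀ : P {ω | D ω = false} ≠ 0) :
    condLaw P Y₀ (alwaysObserved S₀ S₁ ∩ {ω | D ω = false})
      = outcomeLaw (obsLaw P Y₀ Y₁ S₀ S₁ D) false := by
  have := hM.isProbabilityMeasure
  have hS := measurableSet_eq_bool hM.measurable_S₀ true
  have hi : IndepFun D (fun ω => (S₀ ω, Y₀ ω)) P :=
    hM.random_assignment.comp (φ := id)
      (ψ := fun z : Composition k × Composition k × Bool × Bool => (z.2.2.2, z.2.1))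
      measurable_id (by fun_prop)
  have key : ∀ B : Set (Composition k), MeasurableSet B →
      P (({ω | S₀ ω = true} ∩ {ω | D ω = false}) ∩ Y₀ ⁻¹' B)
        = P {ω | D ω = false} * P ({ω | S₀ ω = true} ∩ Y₀ ⁻¹' B) := fun B hB => by
    rw [Set.inter_comm {ω | S₀ ω = true}, Set.inter_assoc]
    exact hi.measure_inter_preimage_eq_mul {false} ({true} ×ˢ B) (measurableSet_singleton _)
      ((measurableSet_singleton _).prod hB)
  have hae : (alwaysObserved S₀ S₁ ∩ {ω | D ω = false} : Set Ω)
      =ᵐ[P] ({ω | S₀ ω = true} ∩ {ω | D ω = false} : Set Ω) :=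
    (alwaysObserved_ae_eq hM).inter (Filter.EventuallyEq.refl _ _)
  rw [outcomeLaw_false hM hD₀, condLaw_eq_smul, measure_congr hae, Measure.restrict_congr_set hae]
  ext B hB
  have hu := key Set.univ .univ
  simp only [Set.preimage_univ, Set.inter_univ] at hu
  rw [Measure.smul_apply, Measure.smul_apply, Measure.map_apply hM.measurable_Y₀ hB, selectedLaw,
    Measure.map_apply hM.measurable_Y₀ hB, Measure.restrict_apply (hM.measurable_Y₀ hB),
    Measure.restrict_apply (hM.measurable_Y₀ hB), Set.inter_comm (Y₀ ⁻¹' B),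
    Set.inter_comm (Y₀ ⁻¹' B), key B hB, hu, smul_eq_mul, smul_eq_mul, inv_mul_mul_cancel hD₀ (measure_ne_top _ _)]

theorem ofReal_selectionRatio (hM : IsSelectionModel P Y₀ Y₁ S₀ S₁ D)
    (hD₁ : P {ω | D ω = true} ≠ 0) (hD₀ : P {ω | D ω = false} ≠ 0)
    (hS : P {ω | S₀ ω = true} ≠ 0) :
    ENNReal.ofReal (selectionRatio (obsLaw P Y₀ Y₁ S₀ S₁ D))
      = (P {ω | S₁ ω = true})⁻¹ * P {ω | S₀ ω = true} := by
  have := hM.isProbabilityMeasure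
  have h1 : P {ω | S₁ ω = true} ≠ 0 := fun h => hS (le_zero_iff.1 (h ▸ measure_selected_le hM))
  rw [selectionRatio_eq hM hD₁ hD₀, ENNReal.ofReal_div_of_pos (by
    exact ENNReal.toReal_pos h1 (measure_ne_top _ _)), ofReal_measureReal, ofReal_measureReal,
    ENNReal.div_eq_inv_mul]

/-- The treated outcomes of the always observed are part of the observed treated outcomes. -/
theorem exists_add_eq_outcomeLaw (hM : IsSelectionModel P Y₀ Y₁ S₀ S₁ D)
    (hD₁ : P {ω | D ω = true} ≠ 0) (hD₀ : P {ω | D ω = false} ≠ 0)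
    (hS : P {ω | S₀ ω = true} ≠ 0) :
    ∃ ν η : Measure (Composition k), ν + η = outcomeLaw (obsLaw P Y₀ Y₁ S₀ S₁ D) true ∧
      ν Set.univ = ENNReal.ofReal (selectionRatio (obsLaw P Y₀ Y₁ S₀ S₁ D)) ∧
      condLaw P Y₁ (alwaysObserved S₀ S₁)
        = (ENNReal.ofReal (selectionRatio (obsLaw P Y₀ Y₁ S₀ S₁ D)))⁻¹ • ν := by
  have := hM.isProbabilityMeasure
  have h1 : P {ω | S₁ ω = true} ≠ 0 := fun h => hS (le_zero_iff.1 (h ▸ measure_selected_le hM))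
  have hA := measurableSet_alwaysObserved hM
  have hsub : alwaysObserved S₀ S₁ ⊆ {ω | S₁ ω = true} := fun ω hω => hω.1
  -- Split the units with `S₁ = 1` into the always observed and the rest, both normalised by `P(S₁ =
  -- 1)`.
  refine ⟨(P {ω | S₁ ω = true})⁻¹ • (P.restrict (alwaysObserved S₀ S₁)).map Y₁,
    (P {ω | S₁ ω = true})⁻¹ • (P.restrict ({ω | S₁ ω = true} \ alwaysObserved S₀ S₁)).map Y₁,
    ?_, ?_, ?_⟩
  · rw [outcomeLaw_true hM hD₁, ← smul_add, ← Measure.map_add _ _ hM.measurable_Y₁, selectedLaw,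
      ← Measure.restrict_union Set.disjoint_sdiff_right
        ((measurableSet_eq_bool hM.measurable_S₁ true).diff hA), Set.union_sdiff_cancel hsub]
  · rw [Measure.smul_apply, Measure.map_apply hM.measurable_Y₁ .univ, Set.preimage_univ,
      Measure.restrict_apply_univ, measure_congr (alwaysObserved_ae_eq hM),
      ofReal_selectionRatio hM hD₁ hD₀ hS, smul_eq_mul]
  · have hfin : (P {ω | S₁ ω = true})⁻¹ ≠ ∞ := ENNReal.inv_ne_top.2 h1
    have hne : (P {ω | S₁ ω = true})⁻¹ ≠ 0 := ENNReal.inv_ne_zero.2 (measure_ne_top _ _)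
    rw [condLaw_eq_smul, ofReal_selectionRatio hM hD₁ hD₀ hS,
      measure_congr (alwaysObserved_ae_eq hM), smul_smul, ENNReal.mul_inv (.inl hne) (.inl hfin),
      mul_right_comm, ENNReal.inv_mul_cancel hne hfin, one_mul]

/-- The joint law of the latent variables of a selection model. -/
noncomputable def jointLaw (P : Measure Ω) (Y₀ Y₁ : Ω → Composition k) (S₀ S₁ D : Ω → Bool) :
    Measure (Latent k) :=
  P.map fun ω => (Y₀ ω, Y₁ ω, S₀ ω, S₁ ω, D ω)

theorem measurable_latent (hM : IsSelectionModel P Y₀ Y₁ S₀ S₁ D) :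
    Measurable fun ω => (Y₀ ω, Y₁ ω, S₀ ω, S₁ ω, D ω) :=
  hM.measurable_Y₀.prodMk (hM.measurable_Y₁.prodMk
    (hM.measurable_S₀.prodMk (hM.measurable_S₁.prodMk hM.measurable_D)))

theorem isModelLaw_jointLaw (hM : IsSelectionModel P Y₀ Y₁ S₀ S₁ D) :
    IsModelLaw (jointLaw P Y₀ Y₁ S₀ S₁ D) where
  isProbabilityMeasure := by
    have := hM.isProbabilityMeasure
    exact Measure.isProbabilityMeasure_map (measurable_latent hM).aemeasurable
  measurable_Y₀ := by fun_prop
  measurable_Y₁ := by fun_prop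
  measurable_S₀ := by fun_prop
  measurable_S₁ := by fun_prop
  measurable_D := by fun_prop
  random_assignment := by
    rw [indepFun_iff_measure_inter_preimage_eq_mul]
    intro s t hs ht
    have hm := measurable_latent hM
    have h1 : MeasurableSet ((fun l : Latent k => l.2.2.2.2) ⁻¹' s) :=
      (show Measurable fun l : Latent k => l.2.2.2.2 by fun_prop) hs
    have h2 : MeasurableSet
        ((fun l : Latent k => (l.2.1, l.1, l.2.2.2.1, l.2.2.1)) ⁻¹' t) :=
      (show Measurable fun l : Latent k => (l.2.1, l.1, l.2.2.2.1, l.2.2.1) by fun_prop) ht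
    rw [jointLaw, Measure.map_apply hm (h1.inter h2), Measure.map_apply hm h1,
      Measure.map_apply hm h2]
    exact hM.random_assignment.measure_inter_preimage_eq_mul s t hs ht
  monotonicity := by
    have hs : MeasurableSet {l : Latent k | l.2.2.1 ≤ l.2.2.2.1} :=
      (show Measurable fun l : Latent k => (l.2.2.1, l.2.2.2.1) by fun_prop)
        (MeasurableSet.of_discrete (s := {b : Bool × Bool | b.1 ≤ b.2}))
    exact (ae_map_iff (measurable_latent hM).aemeasurable hs).2 hM.monotonicity

theorem modelObsLaw_jointLaw (hM : IsSelectionModel P Y₀ Y₁ S₀ S₁ D) :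
    modelObsLaw (jointLaw P Y₀ Y₁ S₀ S₁ D) = obsLaw P Y₀ Y₁ S₀ S₁ D := by
  rw [modelObsLaw, obsLaw, jointLaw,
    Measure.map_map (measurable_observe (isModelLaw_jointLaw hM)) (measurable_latent hM)]
  rfl

theorem condLaw_jointLaw_one (hM : IsSelectionModel P Y₀ Y₁ S₀ S₁ D) :
    condLaw (jointLaw P Y₀ Y₁ S₀ S₁ D) (fun l => l.2.1) (latentAlwaysObserved k)
      = condLaw P Y₁ (alwaysObserved S₀ S₁) := by
  have hA : MeasurableSet (latentAlwaysObserved k) :=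
    measurableSet_alwaysObserved (isModelLaw_jointLaw hM)
  rw [jointLaw, condLaw_map (measurable_latent hM) (by fun_prop) hA]
  rfl

end Model

/-! ### Construction of a model from a part of the treated law -/

/-- A law of `(Y₀, Y₁, S₀, S₁)`: the always observed have treated outcomes `c` and independent
control outcomes with law `G`, units observed only under treatment have outcomes `e`, and the
remaining mass is never observed. Unobserved outcomes are set to `y`. -/
noncomputable def strataLaw {k : ℕ} (G c e : Measure (Composition k)) (y : Composition k) :
    Measure (Composition k × Composition k × Bool × Bool) :=
  (G.prod c).map (fun z => (z.1, z.2, true, true)) + e.map (fun z => (y, z, false, true))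
    + (1 - (c Set.univ + e Set.univ)) • Measure.dirac (y, y, false, false)

section Strata

variable {k : ℕ} {G c e : Measure (Composition k)} {y : Composition k}

theorem strataLaw_apply {E : Set (Composition k × Composition k × Bool × Bool)}
    (hE : MeasurableSet E) : strataLaw G c e y E =
      (G.prod c) {z | (z.1, z.2, true, true) ∈ E} + e {z | (y, z, false, true) ∈ E}
        + (1 - (c Set.univ + e Set.univ)) * E.indicator 1 (y, y, false, false) := by
  rw [strataLaw, Measure.add_apply, Measure.add_apply, Measure.map_apply (by fun_prop) hE,
    Measure.map_apply (by fun_prop) hE, Measure.smul_apply, Measure.dirac_apply' _ hE, smul_eq_mul]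
  rfl

theorem strataLaw_monotone : ∀ᵐ z ∂strataLaw G c e y, z.2.2.1 ≤ z.2.2.2 := by
  have hm : MeasurableSet {z : Composition k × Composition k × Bool × Bool | ¬z.2.2.1 ≤ z.2.2.2} :=
    (show Measurable fun z : Composition k × Composition k × Bool × Bool => z.2.2 by fun_prop)
      (MeasurableSet.of_discrete (s := {b : Bool × Bool | ¬b.1 ≤ b.2}))
  have hb : ¬true < false := by decide
  rw [ae_iff, strataLaw_apply hm]
  simp [hb]

variable [SFinite c]

theorem isProbabilityMeasure_strataLaw [IsProbabilityMeasure G] (h : c Set.univ + e Set.univ ≤ 1) :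
    IsProbabilityMeasure (strataLaw G c e y) := by
  refine ⟨?_⟩
  rw [strataLaw_apply .univ]
  simpa [← Set.univ_prod_univ, Measure.prod_prod] using add_tsub_cancel_of_le h

/-- Only the always observed stratum has `S₀ = 1`; its control marginal is `G` scaled by the mass of
`c`. -/
theorem selectedLaw_strataLaw_zero :
    selectedLaw (strataLaw G c e y) (fun z => z.1) (fun z => z.2.2.1) = c Set.univ • G := by
  have hS : MeasurableSet {z : Composition k × Composition k × Bool × Bool | z.2.2.1 = true} :=
    measurableSet_eq_bool (by fun_prop) true
  ext B hB
  have hB' : MeasurableSet ((fun z : Composition k × Composition k × Bool × Bool => z.1) ⁻¹' B) :=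
    measurable_fst hB
  rw [selectedLaw, Measure.map_apply (by fun_prop) hB, Measure.restrict_apply hB',
    strataLaw_apply (hB'.inter hS)]
  have : {z : Composition k × Composition k | z.1 ∈ B} = B ×ˢ Set.univ := by ext; simp
  simp [this, Measure.prod_prod, mul_comm]

theorem selectedLaw_strataLaw_one [IsProbabilityMeasure G] :
    selectedLaw (strataLaw G c e y) (fun z => z.2.1) (fun z => z.2.2.2) = c + e := by
  have hS : MeasurableSet {z : Composition k × Composition k × Bool × Bool | z.2.2.2 = true} :=
    measurableSet_eq_bool (by fun_prop) true
  ext B hB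
  have hB' : MeasurableSet ((fun z : Composition k × Composition k × Bool × Bool => z.2.1) ⁻¹' B) :=
    (show Measurable fun z : Composition k × Composition k × Bool × Bool => z.2.1 by fun_prop) hB
  rw [selectedLaw, Measure.map_apply (by fun_prop) hB, Measure.restrict_apply hB',
    strataLaw_apply (hB'.inter hS)]
  have : {z : Composition k × Composition k | z.2 ∈ B} = Set.univ ×ˢ B := by ext; simp
  simp [this, Measure.prod_prod]

theorem condLaw_strataLaw_one [IsProbabilityMeasure G] : condLaw (strataLaw G c e y) (fun z => z.2.1)
    (alwaysObserved (fun z => z.2.2.1) fun z => z.2.2.2) = (c Set.univ)⁻¹ • c := by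
  have hS : MeasurableSet (alwaysObserved (fun z : Composition k × Composition k × Bool × Bool =>
      z.2.2.1) fun z => z.2.2.2) :=
    (measurableSet_eq_bool (by fun_prop) true).inter (measurableSet_eq_bool (by fun_prop) true)
  have key : ((strataLaw G c e y).restrict
      (alwaysObserved (fun z => z.2.2.1) fun z => z.2.2.2)).map (fun z => z.2.1) = c := by
    ext B hB
    have hB' : MeasurableSet
        ((fun z : Composition k × Composition k × Bool × Bool => z.2.1) ⁻¹' B) :=
      (show Measurable fun z : Composition k × Composition k × Bool × Bool => z.2.1 by fun_prop) hB
    rw [Measure.map_apply (by fun_prop) hB, Measure.restrict_apply hB',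
      strataLaw_apply (hB'.inter hS)]
    have : {z : Composition k × Composition k | z.2 ∈ B} = Set.univ ×ˢ B := by ext; simp
    simp [this, Measure.prod_prod, alwaysObserved]
  have hmass := congrArg (fun m => m Set.univ) key
  beta_reduce at hmass
  rw [Measure.map_apply (by fun_prop) .univ, Set.preimage_univ, Measure.restrict_apply_univ] at hmass
  rw [condLaw_eq_smul, key, hmass]

/-- Treatment is an independent coordinate of a product space, which is random assignment. -/
theorem isSelectionModel_strataLaw [IsProbabilityMeasure G] (h : c Set.univ + e Set.univ ≤ 1) (δ : Measure Bool)
    [IsProbabilityMeasure δ] :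
    IsSelectionModel ((strataLaw G c e y).prod δ) (fun ω => ω.1.1) (fun ω => ω.1.2.1)
      (fun ω => ω.1.2.2.1) (fun ω => ω.1.2.2.2) (fun ω => ω.2) := by
  have := isProbabilityMeasure_strataLaw (G := G) (y := y) h
  refine ⟨inferInstance, by fun_prop, by fun_prop, by fun_prop, by fun_prop, by fun_prop, ?_, ?_⟩
  · exact (indepFun_prod (X := fun z : Composition k × Composition k × Bool × Bool =>
      (z.2.1, z.1, z.2.2.2, z.2.2.1)) (Y := id) (by fun_prop) measurable_id).symm
  · exact Measure.quasiMeasurePreserving_fst.ae strataLaw_monotone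

end Strata

/-- Every part of the observed treated outcomes with the mass of the always observed is the law of
their treated outcomes in some selection model with the same distribution of the observed data. -/
theorem exists_isModelLaw {k : ℕ} {Ω : Type*} [MeasurableSpace Ω] {P : Measure Ω}
    {Y₀ Y₁ : Ω → Composition k} {S₀ S₁ D : Ω → Bool} (hM : IsSelectionModel P Y₀ Y₁ S₀ S₁ D)
    (hD₁ : P {ω | D ω = true} ≠ 0) (hD₀ : P {ω | D ω = false} ≠ 0)
    (hS : P {ω | S₀ ω = true} ≠ 0) {ν η : Measure (Composition k)}
    (hadd : ν + η = outcomeLaw (obsLaw P Y₀ Y₁ S₀ S₁ D) true)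
    (hν : ν Set.univ = ENNReal.ofReal (selectionRatio (obsLaw P Y₀ Y₁ S₀ S₁ D))) :
    ∃ γ : Measure (Latent k), IsModelLaw γ ∧ modelObsLaw γ = obsLaw P Y₀ Y₁ S₀ S₁ D ∧
      condLaw γ (fun l => l.2.1) (latentAlwaysObserved k)
        = (ENNReal.ofReal (selectionRatio (obsLaw P Y₀ Y₁ S₀ S₁ D)))⁻¹ • ν := by
  have := hM.isProbabilityMeasure
  set a₁ := P {ω | S₁ ω = true} with ha₁
  set a₀ := P {ω | S₀ ω = true} with ha₀
  have h1 : a₁ ≠ 0 := fun h => hS (le_zero_iff.1 (h ▸ measure_selected_le hM))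
  have h1' : a₁ ≠ ∞ := measure_ne_top _ _
  have hν' : ν Set.univ = a₁⁻¹ * a₀ := by rw [hν, ofReal_selectionRatio hM hD₁ hD₀ hS]
  -- `G` is the normalised law of the observed control outcomes. Multiplying `ν` and `η` by `a₁`
  -- below undoes the conditioning on `S₁ = 1`, and then the always observed get mass `a₀`.
  set G := (a₀)⁻¹ • selectedLaw P Y₀ S₀ with hG
  have : IsProbabilityMeasure G := ⟨by
    rw [hG, Measure.smul_apply, selectedLaw_univ P hM.measurable_Y₀, smul_eq_mul,
      ENNReal.inv_mul_cancel hS (measure_ne_top _ _)]⟩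
  have : IsFiniteMeasure ν := ⟨by rw [hν]; exact ENNReal.ofReal_lt_top⟩
  have hsum : a₁ • ν + a₁ • η = selectedLaw P Y₁ S₁ := by
    rw [← smul_add, hadd, outcomeLaw_true hM hD₁, smul_smul, ENNReal.mul_inv_cancel h1 h1', one_smul]
  have hle : (a₁ • ν) Set.univ + (a₁ • η) Set.univ ≤ 1 := by
    rw [← Measure.add_apply, hsum, selectedLaw_univ P hM.measurable_Y₁]
    exact prob_le_one
  have hc : (a₁ • ν) Set.univ = a₀ := by
    rw [Measure.smul_apply, hν', smul_eq_mul, ENNReal.mul_inv_cancel_left h1 h1']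
  have : IsFiniteMeasure (a₁ • ν) := ⟨by rw [hc]; exact measure_lt_top _ _⟩
  have : IsProbabilityMeasure (P.map D) :=
    Measure.isProbabilityMeasure_map hM.measurable_D.aemeasurable
  obtain ⟨ω₀⟩ : Nonempty Ω := nonempty_of_isProbabilityMeasure P
  -- The value `Y₀ ω₀` is an arbitrary filler for outcomes that are never observed.
  set m := strataLaw G (a₁ • ν) (a₁ • η) (Y₀ ω₀) with hm
  have : IsProbabilityMeasure m := isProbabilityMeasure_strataLaw hle
  have hN := isSelectionModel_strataLaw (G := G) (y := Y₀ ω₀) hle (P.map D)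
  have hfst : (m.prod (P.map D)).map Prod.fst = m := by
    rw [Measure.map_fst_prod, measure_univ, one_smul]
  have hsel₀ := selectedLaw_map (P := m.prod (P.map D)) measurable_fst
    (Y := fun z => z.1) (S := fun z => z.2.2.1) (by fun_prop) (by fun_prop)
  have hsel₁ := selectedLaw_map (P := m.prod (P.map D)) measurable_fst
    (Y := fun z => z.2.1) (S := fun z => z.2.2.2) (by fun_prop) (by fun_prop)
  have hcond := condLaw_map (P := m.prod (P.map D)) measurable_fst
    (Y := fun z => z.2.1) (A := alwaysObserved (fun z => z.2.2.1) fun z => z.2.2.2) (by fun_prop)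
    ((measurableSet_eq_bool (by fun_prop) true).inter (measurableSet_eq_bool (by fun_prop) true))
  rw [hfst, hm, selectedLaw_strataLaw_zero, hc, hG, smul_smul,
    ENNReal.mul_inv_cancel hS (measure_ne_top _ _), one_smul] at hsel₀
  rw [hfst, hm, selectedLaw_strataLaw_one, hsum] at hsel₁
  rw [hfst, hm, condLaw_strataLaw_one, hc] at hcond
  have hd : ∀ d, (m.prod (P.map D)) {ω | ω.2 = d} = P {ω | D ω = d} := fun d => by
    have : {ω : (Composition k × Composition k × Bool × Bool) × Bool | ω.2 = d}
      = Set.univ ×ˢ {d} := by ext; simp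
    rw [this, Measure.prod_prod, measure_univ, one_mul,
      Measure.map_apply hM.measurable_D (measurableSet_singleton d)]
    rfl
  refine ⟨_, isModelLaw_jointLaw hN, ?_, ?_⟩
  -- Both models share the law of `D` and the two selected laws, hence the law of the data.
  · rw [modelObsLaw_jointLaw hN, obsLaw_eq hN, obsLaw_eq hM, hd, hd, hsel₀, hsel₁]
  · rw [condLaw_jointLaw_one hN, ofReal_selectionRatio hM hD₁ hD₀ hS,
      ENNReal.mul_inv (.inl (ENNReal.inv_ne_zero.2 h1')) (.inl (ENNReal.inv_ne_top.2 h1)), inv_inv,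
      mul_comm, ← smul_smul]
    exact hcond.symm

/-! ### Transfer between compositions and log-ratios -/

section Means

variable {k : ℕ} {ρ ν : Measure (Composition k)}

theorem HasSecondMoment.mono (h : HasSecondMoment ρ) (hle : ν ≤ ρ) : HasSecondMoment ν :=
  (lintegral_mono' hle le_rfl).trans_lt h

theorem HasSecondMoment.smul (h : HasSecondMoment ρ) {c : ℝ≥0∞} (hc : c ≠ ∞) :
    HasSecondMoment (c • ρ) := by
  rw [HasSecondMoment, lintegral_smul_measure]
  exact ENNReal.mul_lt_top hc.lt_top h

theorem memLp_id_map_clr (h : HasSecondMoment ρ) : MemLp id 2 (ρ.map clr) :=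
  (memLp_map_measure_iff aestronglyMeasurable_id measurable_clr.aemeasurable).2 h.memLp

theorem integral_map_clr : ∫ x, x ∂(ν.map clr) = ∫ z, clr z ∂ν :=
  integral_map measurable_clr.aemeasurable aestronglyMeasurable_id

theorem ae_map_clr_sum_eq_zero : ∀ᵐ x ∂(ρ.map clr), ∑ j, x j = 0 := by
  rw [ae_map_iff measurable_clr.aemeasurable
    (measurableSet_eq_fun (by fun_prop) measurable_const)]
  exact .of_forall sum_clr

/-- A decomposition of the law of `Ψ(Y)` is induced by a decomposition of the law of `Y`. -/
theorem exists_add_eq_map_clr [NeZero k] {ν η : Measure (EuclideanSpace ℝ (Fin k))}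
    (h : ν + η = ρ.map clr) :
    ∃ ν' η' : Measure (Composition k), ν' + η' = ρ ∧ ν'.map clr = ν := by
  have he := measurableEmbedding_clr (k := k)
  -- The sum, and hence the summand `ν`, is carried by the range of `clr`, so pulling it back loses
  -- no mass.
  have hr : (ρ.map clr) (Set.range clr)ᶜ = 0 := by
    rw [Measure.map_apply measurable_clr he.measurableSet_range.compl]
    simp
  refine ⟨ν.comap clr, η.comap clr, ?_, ?_⟩
  · ext B hB
    rw [Measure.add_apply, he.comap_apply, he.comap_apply, ← Measure.add_apply, h,
      ← he.comap_apply, he.comap_map]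
  · rw [he.map_comap, Measure.restrict_eq_self_of_ae_mem]
    have hle : ν ≤ ρ.map clr := h ▸ Measure.le_add_right le_rfl
    exact mem_ae_iff.2 (le_zero_iff.1 ((hle _).trans_eq hr))

/-- The second moment makes the integrability clause automatic. -/
theorem isClrMeanOne_iff {γ : Measure (Latent k)} (h : HasSecondMoment
      (condLaw γ (fun l => l.2.1) (latentAlwaysObserved k)))
    (hp : IsProbabilityMeasure (condLaw γ (fun l => l.2.1) (latentAlwaysObserved k)))
    {v : EuclideanSpace ℝ (Fin k)} : IsClrMeanOne γ v ↔
      v = ∫ z, clr z ∂(condLaw γ (fun l => l.2.1) (latentAlwaysObserved k)) := by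
  have hm : Measurable fun l : Latent k => l.2.1 := by fun_prop
  have hc : AEStronglyMeasurable clr (condLaw γ (fun l => l.2.1) (latentAlwaysObserved k)) :=
    measurable_clr.aestronglyMeasurable
  have hi := h.memLp.integrable (by norm_num)
  rw [condLaw, integrable_map_measure hc hm.aemeasurable] at hi
  rw [IsClrMeanOne, condLaw, integral_map hm.aemeasurable hc]
  exact and_iff_right hi

end Means

/-! ### Identification from the distribution of the data -/

section Identification

variable {k : ℕ} {Ω : Type*} [MeasurableSpace Ω] {P : Measure Ω} {Y₀ Y₁ : Ω → Composition k}
  {S₀ S₁ D : Ω → Bool} {R : Measure (Obs k)}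

/-- Transfers positivity from `R` to any model that generates it, so the results apply both to the
given model and to every competing `γ`. -/
theorem measure_ne_zero_of_obsLaw (hM : IsSelectionModel P Y₀ Y₁ S₀ S₁ D)
    (hR : obsLaw P Y₀ Y₁ S₀ S₁ D = R) (hD : 0 < R {o | o.1 = true})
    (hS : 0 < R {o | o.2.1 = true ∧ o.1 = false}) :
    P {ω | D ω = true} ≠ 0 ∧ P {ω | D ω = false} ≠ 0 ∧ P {ω | S₀ ω = true} ≠ 0 := by
  subst hR
  rw [obsLaw_arm hM] at hD
  rw [obsLaw_selected_false hM] at hS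
  exact ⟨hD.ne', left_ne_zero_of_mul hS.ne', right_ne_zero_of_mul hS.ne'⟩

theorem selectionRatio_mem_Ioc (hM : IsSelectionModel P Y₀ Y₁ S₀ S₁ D)
    (hR : obsLaw P Y₀ Y₁ S₀ S₁ D = R) (hD : 0 < R {o | o.1 = true})
    (hS : 0 < R {o | o.2.1 = true ∧ o.1 = false}) : selectionRatio R ∈ Set.Ioc 0 1 := by
  obtain ⟨hD₁, hD₀, hS₀⟩ := measure_ne_zero_of_obsLaw hM hR hD hS
  subst hR
  have := hM.isProbabilityMeasure
  have h0 : 0 < P.real {ω | S₀ ω = true} := ENNReal.toReal_pos hS₀ (measure_ne_top _ _)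
  have hle : P.real {ω | S₀ ω = true} ≤ P.real {ω | S₁ ω = true} :=
    ENNReal.toReal_mono (measure_ne_top _ _) (measure_selected_le hM)
  rw [selectionRatio_eq hM hD₁ hD₀]
  exact ⟨div_pos h0 (h0.trans_le hle), div_le_one_of_le₀ hle measureReal_nonneg⟩

theorem isProbabilityMeasure_outcomeLaw_false (hM : IsSelectionModel P Y₀ Y₁ S₀ S₁ D)
    (hR : obsLaw P Y₀ Y₁ S₀ S₁ D = R) (hD : 0 < R {o | o.1 = true})
    (hS : 0 < R {o | o.2.1 = true ∧ o.1 = false}) : IsProbabilityMeasure (outcomeLaw R false) := by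
  obtain ⟨-, hD₀, hS₀⟩ := measure_ne_zero_of_obsLaw hM hR hD hS
  subst hR
  have := hM.isProbabilityMeasure
  exact ⟨by rw [outcomeLaw_false hM hD₀, Measure.smul_apply,
    selectedLaw_univ P hM.measurable_Y₀, smul_eq_mul,
    ENNReal.inv_mul_cancel hS₀ (measure_ne_top _ _)]⟩

theorem isProbabilityMeasure_outcomeLaw_true (hM : IsSelectionModel P Y₀ Y₁ S₀ S₁ D)
    (hR : obsLaw P Y₀ Y₁ S₀ S₁ D = R) (hD : 0 < R {o | o.1 = true})
    (hS : 0 < R {o | o.2.1 = true ∧ o.1 = false}) : IsProbabilityMeasure (outcomeLaw R true) := by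
  obtain ⟨hD₁, -, hS₀⟩ := measure_ne_zero_of_obsLaw hM hR hD hS
  subst hR
  have := hM.isProbabilityMeasure
  have h1 : P {ω | S₁ ω = true} ≠ 0 := fun h => hS₀ (le_zero_iff.1 (h ▸ measure_selected_le hM))
  exact ⟨by rw [outcomeLaw_true hM hD₁, Measure.smul_apply,
    selectedLaw_univ P hM.measurable_Y₁, smul_eq_mul,
    ENNReal.inv_mul_cancel h1 (measure_ne_top _ _)]⟩

/-- The mean of the treated outcomes of the always observed lies in the mixture set. -/
theorem treated_alwaysObserved_mem_mixtureSet (hM : IsSelectionModel P Y₀ Y₁ S₀ S₁ D)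
    (hR : obsLaw P Y₀ Y₁ S₀ S₁ D = R) (hD : 0 < R {o | o.1 = true})
    (hS : 0 < R {o | o.2.1 = true ∧ o.1 = false})
    (hmoment : HasSecondMoment (outcomeLaw R true)) :
    IsProbabilityMeasure (condLaw P Y₁ (alwaysObserved S₀ S₁)) ∧
      HasSecondMoment (condLaw P Y₁ (alwaysObserved S₀ S₁)) ∧
      ∫ z, clr z ∂(condLaw P Y₁ (alwaysObserved S₀ S₁)) ∈ mixtureSet R := by
  obtain ⟨hD₁, hD₀, hS₀⟩ := measure_ne_zero_of_obsLaw hM hR hD hS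
  obtain ⟨hp, -⟩ := selectionRatio_mem_Ioc hM hR hD hS
  subst hR
  obtain ⟨ν, η, hadd, hmass, hν⟩ := exists_add_eq_outcomeLaw hM hD₁ hD₀ hS₀
  rw [hν]
  have hp' := ENNReal.ofReal_pos.2 hp
  have hle : ν ≤ outcomeLaw (obsLaw P Y₀ Y₁ S₀ S₁ D) true := hadd ▸ Measure.le_add_right le_rfl
  refine ⟨⟨?_⟩, (hmoment.mono hle).smul (ENNReal.inv_ne_top.2 hp'.ne'), ν.map clr, η.map clr, ?_,
    ?_, ?_⟩
  · rw [Measure.smul_apply, hmass, smul_eq_mul,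
      ENNReal.inv_mul_cancel hp'.ne' ENNReal.ofReal_ne_top]
  · rw [← Measure.map_add _ _ measurable_clr, hadd, treatedLaw]
  · rw [Measure.map_apply measurable_clr .univ, Set.preimage_univ, hmass]
  · rw [integral_smul_measure, ENNReal.toReal_inv, ENNReal.toReal_ofReal hp.le,
      integral_map_clr]

/-- Every point of the mixture set is the mean of the treated outcomes of the always observed in
some selection model. -/
theorem exists_isModelLaw_of_mem_mixtureSet [NeZero k] (hM : IsSelectionModel P Y₀ Y₁ S₀ S₁ D)
    (hR : obsLaw P Y₀ Y₁ S₀ S₁ D = R) (hD : 0 < R {o | o.1 = true})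
    (hS : 0 < R {o | o.2.1 = true ∧ o.1 = false}) {v : EuclideanSpace ℝ (Fin k)}
    (hv : v ∈ mixtureSet R) :
    ∃ γ : Measure (Latent k), IsModelLaw γ ∧ modelObsLaw γ = R ∧
      v = ∫ z, clr z ∂(condLaw γ (fun l => l.2.1) (latentAlwaysObserved k)) := by
  obtain ⟨hD₁, hD₀, hS₀⟩ := measure_ne_zero_of_obsLaw hM hR hD hS
  obtain ⟨hp, -⟩ := selectionRatio_mem_Ioc hM hR hD hS
  subst hR
  obtain ⟨ν, η, hadd, hmass, rfl⟩ := hv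
  obtain ⟨ν', η', hadd', rfl⟩ := exists_add_eq_map_clr hadd
  rw [Measure.map_apply measurable_clr .univ, Set.preimage_univ] at hmass
  obtain ⟨γ, hγ, hγR, hcond⟩ := exists_isModelLaw hM hD₁ hD₀ hS₀ hadd' hmass
  refine ⟨γ, hγ, hγR, ?_⟩
  rw [hcond, integral_smul_measure, ENNReal.toReal_inv, ENNReal.toReal_ofReal hp.le,
      integral_map_clr]

theorem mixtureSet_eq_boundSet [NeZero k] (hM : IsSelectionModel P Y₀ Y₁ S₀ S₁ D)
    (hR : obsLaw P Y₀ Y₁ S₀ S₁ D = R) (hD : 0 < R {o | o.1 = true})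
    (hS : 0 < R {o | o.2.1 = true ∧ o.1 = false})
    (hmoment : HasSecondMoment (outcomeLaw R true))
    (hcont : ∀ u : EuclideanSpace ℝ (Fin k), ‖u‖ = 1 → ∑ j, u j = 0 →
      ∀ t : ℝ, treatedLaw R {x | inner ℝ u x = t} = 0) : mixtureSet R = boundSet R := by
  obtain ⟨hp0, hp1⟩ := selectionRatio_mem_Ioc hM hR hD hS
  have := isProbabilityMeasure_outcomeLaw_true hM hR hD hS
  have : IsProbabilityMeasure ((outcomeLaw R true).map clr) :=
    Measure.isProbabilityMeasure_map measurable_clr.aemeasurable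
  ext v
  exact exists_add_eq_iff_forall_inner_le_upperTailMean (memLp_id_map_clr hmoment)
    ae_map_clr_sum_eq_zero hcont hp0 hp1 v

end Identification

end LeeBounds

theorem mainTheorem2 {k : ℕ} {Ω : Type*} [MeasurableSpace Ω] (P : Measure Ω)
    (Y₀ Y₁ : Ω → LeeBounds.Composition k) (S₀ S₁ D : Ω → Bool)
    (hmodel : LeeBounds.IsSelectionModel P Y₀ Y₁ S₀ S₁ D)
    (R : Measure (LeeBounds.Obs k)) (hR : R = LeeBounds.obsLaw P Y₀ Y₁ S₀ S₁ D)
    -- both arms are assigned, and outcomes are observed in the control arm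
    (hD : 0 < R {o | o.1 = true})
    (hS : 0 < R {o | o.2.1 = true ∧ o.1 = false})
    -- the observed outcome has a finite second moment
    (hmoment : ∀ d, ∫⁻ y, ENNReal.ofReal (‖LeeBounds.clr y‖ ^ 2) ∂(LeeBounds.outcomeLaw R d) < ∞)
    -- continuity in every direction of the hyperplane in which the centred log-ratios live
    (hcont : ∀ u : EuclideanSpace ℝ (Fin k), ‖u‖ = 1 → ∑ j, u j = 0 →
      ∀ t : ℝ, LeeBounds.treatedLaw R {x | inner ℝ u x = t} = 0) :
    (∃ μ₀ : LeeBounds.Composition k,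
      LeeBounds.frechetMeanSet
          (LeeBounds.condLaw P Y₀ (LeeBounds.alwaysObserved S₀ S₁)) = {μ₀} ∧
      LeeBounds.frechetMeanSet
          (LeeBounds.condLaw P Y₀ (LeeBounds.alwaysObserved S₀ S₁ ∩ {ω | D ω = false})) = {μ₀} ∧
      LeeBounds.frechetMeanSet (LeeBounds.outcomeLaw R false) = {μ₀} ∧
      LeeBounds.sharpIdentifiedSet LeeBounds.IsMuZero R = {μ₀}) ∧
    (∃ μ₁ : LeeBounds.Composition k,
      LeeBounds.frechetMeanSet
          (LeeBounds.condLaw P Y₁ (LeeBounds.alwaysObserved S₀ S₁)) = {μ₁} ∧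
      μ₁ ∈ LeeBounds.clr ⁻¹' LeeBounds.boundSet R) ∧
    LeeBounds.sharpIdentifiedSet LeeBounds.IsClrMeanOne R = LeeBounds.boundSet R ∧
    LeeBounds.mixtureSet R = LeeBounds.boundSet R ∧
    LeeBounds.sharpIdentifiedSet LeeBounds.IsMuOne R = LeeBounds.clr ⁻¹' LeeBounds.boundSet R := by
  have := hmodel.isProbabilityMeasure
  obtain ⟨ω₀⟩ : Nonempty Ω := nonempty_of_isProbabilityMeasure P
  -- The values of `Y₀` are compositions, and there are none with zero parts.
  have : NeZero k := ⟨by rintro rfl; exact isEmptyElim (Y₀ ω₀)⟩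
  have hR' := hR.symm
  obtain ⟨-, hD₀, -⟩ := LeeBounds.measure_ne_zero_of_obsLaw hmodel hR' hD hS
  have hp₀ := LeeBounds.isProbabilityMeasure_outcomeLaw_false hmodel hR' hD hS
  have hmix := LeeBounds.mixtureSet_eq_boundSet hmodel hR' hD hS (hmoment true) hcont
  -- the treated outcomes of the always observed in an arbitrary model of the observed data
  have htreated : ∀ γ : Measure (LeeBounds.Latent k), LeeBounds.IsModelLaw γ →
      LeeBounds.modelObsLaw γ = R → _ := fun γ hγ hγR =>
    LeeBounds.treated_alwaysObserved_mem_mixtureSet hγ hγR hD hS (hmoment true)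
  refine ⟨?_, ?_, ?_, hmix, ?_⟩
  · obtain ⟨m, hm⟩ := LeeBounds.exists_clr_eq_integral
      ((LeeBounds.HasSecondMoment.memLp (hmoment false)).integrable (by norm_num))
    have hF := LeeBounds.frechetMeanSet_eq_singleton (hmoment false) hm
    refine ⟨m, ?_, ?_, hF, ?_⟩
    · rwa [LeeBounds.condLaw_alwaysObserved_zero hmodel hD₀, ← hR]
    · rwa [LeeBounds.condLaw_alwaysObserved_zero_control hmodel hD₀, ← hR]
    · have hzero : ∀ γ : Measure (LeeBounds.Latent k), LeeBounds.IsModelLaw γ →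
          LeeBounds.modelObsLaw γ = R → ∀ m', LeeBounds.IsMuZero γ m' ↔ m = m' := by
        intro γ hγ hγR m'
        obtain ⟨-, hγD, -⟩ := LeeBounds.measure_ne_zero_of_obsLaw hγ hγR hD hS
        have h := LeeBounds.condLaw_alwaysObserved_zero hγ hγD
        change _ = LeeBounds.outcomeLaw (LeeBounds.modelObsLaw γ) false at h
        rw [hγR] at h
        change LeeBounds.frechetMeanSet (LeeBounds.condLaw γ (fun l => l.1)
          (LeeBounds.alwaysObserved _ _)) = {m'} ↔ _
        rw [h, hF, Set.singleton_eq_singleton_iff]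
      refine Set.eq_singleton_iff_unique_mem.2 ⟨?_, ?_⟩
      -- The identified set is nonempty because the joint law of the given model itself generates
      -- `R`.
      · have hγ := LeeBounds.isModelLaw_jointLaw hmodel
        have hγR := (LeeBounds.modelObsLaw_jointLaw hmodel).trans hR'
        exact ⟨_, hγ, hγR, (hzero _ hγ hγR m).2 rfl⟩
      · rintro m' ⟨γ, hγ, hγR, hm'⟩
        exact ((hzero γ hγ hγR m').1 hm').symm
  · obtain ⟨hp, h2, hmem⟩ :=
      LeeBounds.treated_alwaysObserved_mem_mixtureSet hmodel hR' hD hS (hmoment true)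
    obtain ⟨m, hm⟩ := LeeBounds.exists_clr_eq_integral (h2.memLp.integrable (by norm_num))
    refine ⟨m, LeeBounds.frechetMeanSet_eq_singleton h2 hm, ?_⟩
    rwa [Set.mem_preimage, hm, ← hmix]
  · rw [← hmix]
    ext v
    constructor
    · rintro ⟨γ, hγ, hγR, hv⟩
      obtain ⟨hp, h2, hmem⟩ := htreated γ hγ hγR
      rwa [(LeeBounds.isClrMeanOne_iff h2 hp).1 hv]
    · intro hv
      obtain ⟨γ, hγ, hγR, hγv⟩ :=
        LeeBounds.exists_isModelLaw_of_mem_mixtureSet hmodel hR' hD hS hv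
      obtain ⟨hp, h2, -⟩ := htreated γ hγ hγR
      exact ⟨γ, hγ, hγR, (LeeBounds.isClrMeanOne_iff h2 hp).2 hγv⟩
  · rw [← hmix]
    ext m
    constructor
    · rintro ⟨γ, hγ, hγR, hm⟩
      obtain ⟨hp, h2, hmem⟩ := htreated γ hγ hγR
      obtain ⟨m', hm'⟩ := LeeBounds.exists_clr_eq_integral (h2.memLp.integrable (by norm_num))
      -- Uniqueness of the Fréchet mean identifies `m` with the composition `m'` built from the
      -- Euclidean mean.
      have h := (LeeBounds.frechetMeanSet_eq_singleton h2 hm').symm.trans hm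
      rw [Set.mem_preimage, ← Set.singleton_eq_singleton_iff.1 h, hm']
      exact hmem
    · intro hm
      obtain ⟨γ, hγ, hγR, hγm⟩ :=
        LeeBounds.exists_isModelLaw_of_mem_mixtureSet hmodel hR' hD hS hm
      obtain ⟨hp, h2, -⟩ := htreated γ hγ hγR
      exact ⟨γ, hγ, hγR, LeeBounds.frechetMeanSet_eq_singleton h2 hγm⟩
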